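/- Let $k,n\ge 1$ be integers, $\kappa$ a nonzero complex number, and $P_{kn}=\mathbb C[x_{ai}]$, $1\le a\le k$, $1\le i\le n$, with $\partial_{ai}=\partial/\partial x_{ai}$. **Actions.** For $\mathfrak{gl}_k$, let $V^{(k)}_\bullet=\mathbb C[x_1,\dots,x_k]$ with $e_{ab}\mapsto x_a\partial_b$, and $V^{(k)}_\bullet=\bigoplus_l V^{(k)}_l$ the decomposition by degree. Identify $P_{kn}$ with $(V^{(k)}_\bullet)^{\otimes n}$ by $p_1\otimes\dots\otimes p_n\mapsto\prod_i p_i(x_{1i},\dots,x_{ki})$, so that $e_{ab}$ acts in the $i$-th factor by $(e_{ab})_{(i)}=x_{ai}\partial_{bi}$, and $e_{ab}=\sum_i (e_{ab})_{(i)}$. Likewise identify $P_{kn}$ with $(V^{(n)}_\bullet)^{\otimes k}$ by $p_1\otimes\dots\otimes p_k\mapsto\prod_a p_a(x_{a1},\dots,x_{an})$, so that $e_{ij}\in\mathfrak{gl}_n$ acts in the $a$-th factor by $x_{ai}\partial_{aj}$. **Operators for $\mathfrak{gl}_k$.** They act on $P_{kn}$-valued functions of $z=(z_1,\dots,z_n)$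 and $\lambda=(\lambda_1,\dots,\lambda_k)$. Put $z_{ij}=z_i-z_j$, $\lambda_{ab}=\lambda_a-\lambda_b$, $\Omega=\sum_{a,b}e_{ab}\otimes e_{ba}$, $\Omega^{\pm}$ with $\Omega^{+}=\frac12\sum_a e_{aa}\otimes e_{aa}+\sum_{a<b}e_{ab}\otimes e_{ba}$ and $\Omega^{-}=\frac12\sum_a e_{aa}\otimes e_{aa}+\sum_{a<b}e_{ba}\otimes e_{ab}$. Set $$\nabla_{z_i}(z;\lambda)=\kappa\frac{\partial}{\partial z_i}-\sum_a\lambda_a(e_{aa})_{(i)}-\sum_{j\ne i}\frac{\Omega_{(ij)}}{z_i-z_j},$$ $$\widehat\nabla_{z_i}(z;\lambda)=\kappa z_i\frac{\partial}{\partial z_i}-\sum_a\Bigl(\lambda_a-\frac{e_{aa}}2\Bigr)(e_{aa})_{(i)}-\sum_{j\ne i}\frac{z_i\Omega^+_{(ij)}+z_j\Omega^-_{(ij)}}{z_i-z_j},$$ $$D_{\lambda_a}(z;\lambda)=\kappa\frac{\partial}{\partial\lambda_a}-\sum_i z_i(e_{aa})_{(i)}-\sum_{b\ne a}\frac{e_{ab}e_{ba}-e_{aa}}{\lambda_a-\lambda_b},$$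 $$\widehat D_{\lambda_a}(z;\lambda)=\kappa\lambda_a\frac{\partial}{\partial\lambda_a}+\frac{e_{aa}^2}2-\sum_i z_i(e_{aa})_{(i)}-\sum_{b=1}^k\sum_{i<j}(e_{ab})_{(i)}(e_{ba})_{(j)}-\sum_{b\ne a}\frac{\lambda_b}{\lambda_a-\lambda_b}(e_{ab}e_{ba}-e_{aa}).$$ For $a\ne b$ put $$B_{ab}(t)=1+\sum_{s\ge1}e_{ba}^s e_{ab}^s\prod_{j=1}^s\frac1{j(t-e_{aa}+e_{bb}-j)},\qquad C_{ab}(t)=\frac{\Gamma(t+1)\,\Gamma(t-e_{aa}+e_{bb})}{\Gamma(t-e_{aa})\,\Gamma(t+e_{bb}+1)},$$ where functions of the $e_{aa}$ act on monomials through their eigenvalues. For $t\notin\mathbb Z$ let $R(t)$ be the endomorphism of $V^{(k)}_\bullet\otimes V^{(k)}_\bullet$ that preserves every $V^{(k)}_l\otimes V^{(k)}_m$, commutes with $g\otimes1+1\otimes g$ for $g\in\mathfrak{gl}_k$, satisfies $$R(t)\Bigl(t\,e_{ab}\otimes1+\sum_c e_{ac}\otimes e_{cb}\Bigr)=\Bigl(t\,e_{ab}\otimes1+\sum_c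 e_{cb}\otimes e_{ac}\Bigr)R(t)\quad\text{for all }a,b,$$ and fixes $x_1^l\otimes x_1^m$ for all $l,m\ge0$. Let $R_{ij}(t)$ be $R(t)$ acting in the $i$-th and $j$-th factors. Let $T_u$ be the shift $(T_uf)(u)=f(u+\kappa)$, and set $$Z_{z_i}(z;\lambda)=\bigl(R_{in}(z_{in})\cdots R_{i,i+1}(z_{i,i+1})\bigr)^{-1}\prod_{a=1}^k\bigl(\lambda_a^{-e_{aa}}\bigr)_{(i)}\,R_{1i}(z_{1i}-\kappa)\cdots R_{i-1,i}(z_{i-1,i}-\kappa)\,T_{z_i},$$ $$Q_{\lambda_a}(z;\lambda)=\bigl(B_{ak}(\lambda_{ak})\cdots B_{a,a+1}(\lambda_{a,a+1})\bigr)^{-1}\prod_{i=1}^n\bigl(z_i^{-e_{aa}}\bigr)_{(i)}\,B_{1a}(\lambda_{1a}-\kappa)\cdots B_{a-1,a}(\lambda_{a-1,a}-\kappa)\,T_{\lambda_a},$$ $$N_a(\lambda)=\prod_{1\le b<a}C_{ba}(\lambda_{ba}-\kappa)\prod_{a<b\le k}C_{ab}(\lambda_{ab})^{-1}.$$ A superscript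 $(k)$ marks these operators for $\mathfrak{gl}_k$. A superscript $(n)$ marks those for $\mathfrak{gl}_n$, which are given by the same formulas with $k$ and $n$ exchanged, with $\lambda$ in the role of $z$ and $z$ in the role of $\lambda$ (indicated by the arguments $(\lambda;z)$), acting on $P_{kn}=(V^{(n)}_\bullet)^{\otimes k}$. Write $F\simeq G$ if $F$ and $G$ act on $P_{kn}$-valued functions of $(z,\lambda)$ in the same way. **Theorem.** For $t\notin\mathbb Z$ the operator $R(t)$ exists and is unique, both for $\mathfrak{gl}_k$ and for $\mathfrak{gl}_n$, and all $R_{ij}(t)$ and $B_{ij}(t)$ with $i\neq j$, for either algebra, are invertible on $P_{kn}$, so that the operators above are well defined for generic $z,\lambda$. For all $i=1,\dots,n$ and $a=1,\dots,k$, $$\nabla^{(k)}_{z_i}(z;\lambda)\simeq D^{(n)}_{z_i}(\lambda;z),\qquad D^{(k)}_{\lambda_a}(z;\lambda)\simeq\nabla^{(n)}_{\lambda_a}(\lambda;z),$$ $$\widehat\nabla^{(k)}_{z_i}(z;\lambda)\simeq\widehat D^{(n)}_{z_i}(\lambda;z),\qquad \widehat D^{(k)}_{\lambda_a}(z;\lambda)\simeq\widehat\nabla^{(n)}_{\lambda_a}(\lambda;z),$$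 $$Z^{(k)}_{z_i}(z;\lambda)\simeq N^{(n)}_i(z)\,Q^{(n)}_{z_i}(\lambda;z),\qquad N^{(k)}_a(\lambda)\,Q^{(k)}_{\lambda_a}(z;\lambda)\simeq Z^{(n)}_{\lambda_a}(\lambda;z).$$ The identities in the first two rows hold for functions holomorphic on an open set (locally with values in a finite-dimensional subspace of $P_{kn}$), at all points of it with $z_j\ne z_i$ for $j\ne i$ (left column), respectively $\lambda_b\ne\lambda_a$ for $b\neq a$ (right column). Those in the third row hold for all functions, at all points where every $\lambda_b\ne0$, $z_{ji}-\kappa\notin\mathbb Z$ for $j<i$ and $z_{ij}\notin\mathbb Z$ for $j>i$ (left), respectively every $z_j\ne0$, $\lambda_{ba}-\kappa\notin\mathbb Z$ for $b<a$ and $\lambda_{ab}\notin\mathbb Z$ for $b>a$ (right). -/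

import Mathlib

noncomputable section

namespace GlDuality

open MvPolynomial

/-! ## The polynomial module

`P k n` is the polynomial ring in the variables `x_{ai}`, `a : Fin k`, `i : Fin n`.  It is treated as
the `n`-fold tensor product `V ⊗ ⋯ ⊗ V` of the `gl_k`-module `V = ℂ[x_1, …, x_k]` (with `e_{ab}` acting
as `x_a ∂_b`) through `p_1 ⊗ ⋯ ⊗ p_n ↦ ∏_i p_i (x_{1i}, …, x_{ki})`; the `i`-th tensor factor is the
polynomial ring in the `i`-th column of variables.

Everything below is defined for `gl_k` acting on `P k n`, for arbitrary `k` and `n`.  The `gl_n`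
version is the same definition with `k` and `n` exchanged, acting on `P n k`; the two modules
are identified by transposing the variables, `x_{ai} ↔ x_{ia}` (see `transpose` and `dualize`). -/

/-- The polynomial ring `ℂ[x_{ai}]`, `a : Fin k`, `i : Fin n`. -/
abbrev P (k n : ℕ) : Type := MvPolynomial (Fin k × Fin n) ℂ

/-- `P k n`-valued functions `u (z; l)` of `z_1, …, z_n` and `l_1, …, l_k`. -/
abbrev Fn (k n : ℕ) : Type := (Fin n → ℂ) → (Fin k → ℂ) → P k n

variable {k n : ℕ}

/-- `(e_{ab})_{(i)}`: the generator `e_{ab}` of `gl_k` acting in the `i`-th tensor factor,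
that is, `x_{ai} ∂/∂x_{bi}`. -/
def eSlot (a b : Fin k) (i : Fin n) : Module.End ℂ (P k n) :=
  LinearMap.mulLeft ℂ (X (a, i)) ∘ₗ (pderiv (R := ℂ) (b, i)).toLinearMap

/-- The generator `e_{ab}` of `gl_k` acting on the whole tensor product. -/
def eTot (a b : Fin k) : Module.End ℂ (P k n) := ∑ i : Fin n, eSlot a b i

/-- A function of the commuting operators `(e_{aa})_{(i)}`: these act on the monomial `x^d` as
multiplication by the integers `d (a, i)`, and a function of them acts by its value there. -/
def weightOp (f : (Fin k × Fin n →₀ ℕ) → ℂ) : Module.End ℂ (P k n) :=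
  (basisMonomials (Fin k × Fin n) ℂ).constr ℂ (fun d => f d • monomial d (1 : ℂ))

/-- The eigenvalue of `e_{aa}` on the monomial `x^d`. -/
def wt (a : Fin k) (d : Fin k × Fin n →₀ ℕ) : ℂ := ∑ i : Fin n, (d (a, i) : ℂ)

/-! ## Holomorphic functions and partial derivatives -/

/-- `u` is holomorphic on the (open) set `U`: locally it takes values in a fixed
finite-dimensional subspace of `P k n`, and its coefficients are holomorphic. -/
def IsHolo (U : Set ((Fin n → ℂ) × (Fin k → ℂ))) (u : Fn k n) : Prop :=
  (∀ d, DifferentiableOn ℂ (fun p : (Fin n → ℂ) × (Fin k → ℂ) => coeff d (u p.1 p.2)) U) ∧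
  ∀ p ∈ U, ∃ S : Finset (Fin k × Fin n →₀ ℕ), ∀ᶠ q in nhds p, (u q.1 q.2).support ⊆ S

/-- `∂u/∂z_i`, computed coefficient by coefficient. -/
def dZ (i : Fin n) (u : Fn k n) : Fn k n := fun z l =>
  ∑ᶠ d : Fin k × Fin n →₀ ℕ,
    monomial d (deriv (fun s : ℂ => coeff d (u (Function.update z i s) l)) (z i))

/-- `∂u/∂l_a`, computed coefficient by coefficient. -/
def dL (a : Fin k) (u : Fn k n) : Fn k n := fun z l =>
  ∑ᶠ d : Fin k × Fin n →₀ ℕ,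
    monomial d (deriv (fun s : ℂ => coeff d (u z (Function.update l a s))) (l a))

/-! ## Knizhnik–Zamolodchikov operators -/

/-- The Casimir tensor `Ω` in the tensor factors `i`, `j`. -/
def casimir (i j : Fin n) : Module.End ℂ (P k n) :=
  ∑ a : Fin k, ∑ b : Fin k, eSlot a b i * eSlot b a j

/-- `Ω⁰ = ½ ∑_a e_{aa} ⊗ e_{aa}` in the tensor factors `i`, `j`. -/
def casimirZero (i j : Fin n) : Module.End ℂ (P k n) :=
  (1 / 2 : ℂ) • ∑ a : Fin k, eSlot a a i * eSlot a a j

/-- `Ω⁺ = Ω⁰ + ∑_{a<b} e_{ab} ⊗ e_{ba}` in the tensor factors `i`, `j`. -/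
def casimirPlus (i j : Fin n) : Module.End ℂ (P k n) :=
  casimirZero i j + ∑ a : Fin k, ∑ b : Fin k with a < b, eSlot a b i * eSlot b a j

/-- `Ω⁻ = Ω⁰ + ∑_{a<b} e_{ba} ⊗ e_{ab}` in the tensor factors `i`, `j`. -/
def casimirMinus (i j : Fin n) : Module.End ℂ (P k n) :=
  casimirZero i j + ∑ a : Fin k, ∑ b : Fin k with a < b, eSlot b a i * eSlot a b j

/-- The rational KZ operator `∇_{z_i}(z; l)` for `gl_k`. -/
def ratKZ (κ : ℂ) (i : Fin n) (u : Fn k n) : Fn k n := fun z l =>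
  κ • dZ i u z l
    - ∑ a : Fin k, l a • eSlot a a i (u z l)
    - ∑ j : Fin n with j ≠ i, (1 / (z i - z j)) • casimir i j (u z l)

/-- The trigonometric KZ operator for `gl_k` (with respect to `z_i`). -/
def trigKZ (κ : ℂ) (i : Fin n) (u : Fn k n) : Fn k n := fun z l =>
  (κ * z i) • dZ i u z l
    - ∑ a : Fin k, ((l a • 1 - (1 / 2 : ℂ) • eTot a a) * eSlot a a i : Module.End ℂ (P k n)) (u z l)
    - ∑ j : Fin n with j ≠ i,
        (1 / (z i - z j)) • (z i • casimirPlus i j + z j • casimirMinus i j : Module.End ℂ (P k n)) (u z l)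

/-! ## Differential dynamical operators -/

/-- The rational differential dynamical operator `D_{l_a}(z; l)` for `gl_k`. -/
def ratDD (κ : ℂ) (a : Fin k) (u : Fn k n) : Fn k n := fun z l =>
  κ • dL a u z l
    - ∑ i : Fin n, z i • eSlot a a i (u z l)
    - ∑ b : Fin k with b ≠ a,
        (1 / (l a - l b)) • (eTot a b * eTot b a - eTot a a : Module.End ℂ (P k n)) (u z l)

/-- The trigonometric differential dynamical operator for `gl_k` (with respect to `l_a`). -/
def trigDD (κ : ℂ) (a : Fin k) (u : Fn k n) : Fn k n := fun z l =>
  (κ * l a) • dL a u z l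
    + (1 / 2 : ℂ) • (eTot a a * eTot a a : Module.End ℂ (P k n)) (u z l)
    - ∑ i : Fin n, z i • eSlot a a i (u z l)
    - ∑ b : Fin k, ∑ i : Fin n, ∑ j : Fin n with i < j, (eSlot a b i * eSlot b a j : Module.End ℂ (P k n)) (u z l)
    - ∑ b : Fin k with b ≠ a,
        (l b / (l a - l b)) • (eTot a b * eTot b a - eTot a a : Module.End ℂ (P k n)) (u z l)

/-! ## Difference dynamical operators -/

/-- The series `B_{ab}(t) = ∑_{s ≥ 0} e_{ba}^s e_{ab}^s ∏_{j=1}^s 1 / (j (t - e_{aa} + e_{bb} - j))`.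
On every monomial only finitely many terms are nonzero. -/
def dynB (a b : Fin k) (t : ℂ) : Module.End ℂ (P k n) :=
  (basisMonomials (Fin k × Fin n) ℂ).constr ℂ (fun d =>
    ∑ᶠ s : ℕ, (∏ j ∈ Finset.Icc 1 s, 1 / ((j : ℂ) * (t - wt a d + wt b d - (j : ℂ)))) •
      (eTot b a ^ s * eTot a b ^ s : Module.End ℂ (P k n)) (monomial d (1 : ℂ)))

/-- `B_{ak}(l_{ak}) ⋯ B_{a,a+1}(l_{a,a+1})`, where `l_{ab} = l_a - l_b`. -/
def dynLeft (a : Fin k) (l : Fin k → ℂ) : Module.End ℂ (P k n) :=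
  (((List.finRange k).filter (fun b => a < b)).reverse.map
    (fun b => dynB a b (l a - l b))).prod

/-- `B_{1a}(l_{1a} - κ) ⋯ B_{a-1,a}(l_{a-1,a} - κ)`. -/
def dynRight (κ : ℂ) (a : Fin k) (l : Fin k → ℂ) : Module.End ℂ (P k n) :=
  (((List.finRange k).filter (fun b => b < a)).map
    (fun b => dynB b a (l b - l a - κ))).prod

/-- `X_a(z; l)`; the middle factor is `∏_i (z_i^{-e_{aa}})_{(i)}`. -/
def dynX (κ : ℂ) (a : Fin k) (z : Fin n → ℂ) (l : Fin k → ℂ) : Module.End ℂ (P k n) :=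
  Ring.inverse (dynLeft a l)
    * weightOp (fun d => ∏ i : Fin n, z i ^ (-(d (a, i) : ℤ)))
    * dynRight κ a l

/-- The difference dynamical operator `Q_{l_a}(z; l) = X_a(z; l) T_{l_a}` for `gl_k`. -/
def diffDyn (κ : ℂ) (a : Fin k) (u : Fn k n) : Fn k n := fun z l =>
  dynX κ a z l (u z (Function.update l a (l a + κ)))

/-! ## R-matrices and the quantized Knizhnik–Zamolodchikov operators -/

/-- The subspace `V_p ⊗ V_q` of `V ⊗ V = P k 2`, where `V_p` is the space of homogeneous
polynomials of degree `p`. -/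
def bihom (k p q : ℕ) : Submodule ℂ (P k 2) :=
  Submodule.span ℂ {f | ∃ d : Fin k × Fin 2 →₀ ℕ,
    (∑ a : Fin k, d (a, 0) = p) ∧ (∑ a : Fin k, d (a, 1) = q) ∧ f = monomial d 1}

/-- `R` is the value at `t` of the rational R-matrix of `V ⊗ V = ⨁ V_p ⊗ V_q`: it preserves each
summand, commutes with `gl_k`, satisfies the commutation relations with the Yangian, and fixes
the product `x_1^p ⊗ x_1^q` of the highest weight vectors for all `p`, `q`. -/
structure IsRMatrix (k : ℕ) [NeZero k] (t : ℂ) (R : Module.End ℂ (P k 2)) : Prop where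
  map_bihom : ∀ p q : ℕ, ∀ f ∈ bihom k p q, R f ∈ bihom k p q
  invariant : ∀ a b : Fin k,
    R * (eSlot a b 0 + eSlot a b 1) = (eSlot a b 0 + eSlot a b 1) * R
  intertwine : ∀ a b : Fin k,
    R * (t • eSlot a b 0 + ∑ c : Fin k, eSlot a c 0 * eSlot c b 1)
      = (t • eSlot a b 0 + ∑ c : Fin k, eSlot c b 0 * eSlot a c 1) * R
  normalized : ∀ p q : ℕ,
    R (X (0, 0) ^ p * X (0, 1) ^ q) = X (0, 0) ^ p * X (0, 1) ^ q

open Classical in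
/-- The rational R-matrix `R(t)` of `gl_k` acting in `V ⊗ V` (determined by its properties
for `t ∉ ℤ`). -/
def rMatrix (k : ℕ) [NeZero k] (t : ℂ) : Module.End ℂ (P k 2) :=
  if h : ∃ R, IsRMatrix k t R then h.choose else 0

/-- `A_{(ij)}`, `i ≠ j`: an endomorphism `A` of `V ⊗ V` acting in the tensor factors `i`, `j` (in
this order) of the `n`-fold tensor product.  The variables in the columns different from
`i`, `j` are treated as constants. -/
def pairOp (i j : Fin n) (A : Module.End ℂ (P k 2)) : Module.End ℂ (P k n) :=
  (basisMonomials (Fin k × Fin n) ℂ).constr ℂ (fun d =>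
    rename (fun p : Fin k × Fin 2 => (p.1, ![i, j] p.2))
        (A (monomial (Finsupp.equivFunOnFinite.symm
          (fun p : Fin k × Fin 2 => d (p.1, ![i, j] p.2))) (1 : ℂ)))
      * monomial (d.filter (fun p => p.2 ≠ i ∧ p.2 ≠ j)) (1 : ℂ))

/-- `R_{ij}(t)`. -/
def rOp [NeZero k] (i j : Fin n) (t : ℂ) : Module.End ℂ (P k n) := pairOp i j (rMatrix k t)

/-- `R_{in}(z_{in}) ⋯ R_{i,i+1}(z_{i,i+1})`, where `z_{ij} = z_i - z_j`. -/
def rLeft [NeZero k] (i : Fin n) (z : Fin n → ℂ) : Module.End ℂ (P k n) :=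
  (((List.finRange n).filter (fun j => i < j)).reverse.map
    (fun j => rOp i j (z i - z j))).prod

/-- `R_{1i}(z_{1i} - κ) ⋯ R_{i-1,i}(z_{i-1,i} - κ)`. -/
def rRight [NeZero k] (κ : ℂ) (i : Fin n) (z : Fin n → ℂ) : Module.End ℂ (P k n) :=
  (((List.finRange n).filter (fun j => j < i)).map
    (fun j => rOp j i (z j - z i - κ))).prod

/-- `K_i(z; l)`; the middle factor is `∏_a (l_a^{-e_{aa}})_{(i)}`. -/
def qkzK [NeZero k] (κ : ℂ) (i : Fin n) (z : Fin n → ℂ) (l : Fin k → ℂ) :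
    Module.End ℂ (P k n) :=
  Ring.inverse (rLeft i z)
    * weightOp (fun d => ∏ a : Fin k, l a ^ (-(d (a, i) : ℤ)))
    * rRight κ i z

/-- The rational qKZ operator `Z_{z_i}(z; l) = K_i(z; l) T_{z_i}` for `gl_k`. -/
def qKZ [NeZero k] (κ : ℂ) (i : Fin n) (u : Fn k n) : Fn k n := fun z l =>
  qkzK κ i z l (u (Function.update z i (z i + κ)) l)

/-! ## The normalization factors -/

/-- The value of `C_{ab}(t) = Γ(t+1) Γ(t-e_{aa}+e_{bb}) / (Γ(t-e_{aa}) Γ(t+e_{bb}+1))` on `x^d`. -/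
def cVal (a b : Fin k) (t : ℂ) (d : Fin k × Fin n →₀ ℕ) : ℂ :=
  Complex.Gamma (t + 1) * Complex.Gamma (t - wt a d + wt b d) /
    (Complex.Gamma (t - wt a d) * Complex.Gamma (t + wt b d + 1))

/-- `N_a(l) = ∏_{b<a} C_{ba}(l_{ba} - κ) ∏_{a<b} C_{ab}(l_{ab})⁻¹` for `gl_k`. -/
def normN (κ : ℂ) (a : Fin k) (l : Fin k → ℂ) : Module.End ℂ (P k n) :=
  weightOp (fun d =>
    (∏ b : Fin k with b < a, cVal b a (l b - l a - κ) d) *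
      ∏ b : Fin k with a < b, (cVal a b (l a - l b) d)⁻¹)

/-! ## The duality -/

/-- The identification of `P k n` with `P n k` by transposing the variables. -/
def transpose (k n : ℕ) : P k n ≃ₐ[ℂ] P n k := renameEquiv ℂ (Equiv.prodComm (Fin k) (Fin n))

/-- A `P k n`-valued function of `(z; l)` regarded as a `P n k`-valued function of `(l; z)`. -/
def dualize (u : Fn k n) : Fn n k := fun l z => transpose k n (u z l)

/-- `t` is not an integer. -/
def NotInt (t : ℂ) : Prop := ∀ m : ℤ, t ≠ (m : ℂ)

end GlDuality

end

noncomputable section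
namespace GlDuality
open MvPolynomial

/-! ## Multiplication and differentiation operators, transposition -/

section WeylAlgebra

variable {k n : ℕ}

/-! Both Lie algebras act on `P k n` inside one Weyl algebra, generated by the `x_{ai}` and
`∂_{ai}`. Transposing the variables turns every assertion into an identity between operators on `P n
k`, and since transposition is an involution, the right-hand column of each pair follows from the
left-hand one with `k` and `n` exchanged.

For the differential operators the identities come from normal ordering. For `i ≠ j` the tensor
`Ω_{(ij)}` of `gl_k` becomes `e_{ij} e_{ji} - e_{ii}` for `gl_n` (`transEnd_casimir`); the
subtracted term is the commutator `[∂, x]`. In the trigonometric case the poles are treated in the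
same way, and the part without poles is the identity `transEnd_trig_identity`.

For the difference operators the point is that the R-matrix of `gl_k` is the transpose of `C_{12}(t)
B_{12}(t)` for `gl_2` (`isRMatrix_transEnd`). Its invariance under `gl_k` holds because the two Lie
algebras commute. The Yangian relation holds because, term by term in the series `B`, the failure of
the relation is a difference of consecutive boundary terms, and the coefficients of the series make
the sum telescope (`dynB_mul_intertwinerSource`). The normalization is the Chu–Vandermonde identity
(`normalizedDynB_X_pow`). Such an operator is unique because the vectors `x_1^p ⊗ x_1^q` generate `V
⊗ V` under the operators it intertwines (`eq_top_of_cyclic`). The same cyclicity gives unitarity,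
`R_{21}(-t) R_{12}(t) = 1`, hence invertibility of `R`, and through the duality that of `B`.

Passing from two tensor factors to factors `i`, `j` of many (`transEnd_rOp`), each product of
R-matrices becomes a product of factors `C B`. As `B` preserves weights, the functions `C` of the
weights move to the left and combine into `N` (`transEnd_qkzK`). -/

/-- Multiplication by the variable `X p`. -/
def mulX {σ : Type*} (p : σ) : Module.End ℂ (MvPolynomial σ ℂ) := LinearMap.mulLeft ℂ (X p)

/-- The partial derivative with respect to `X p`. -/
def dX {σ : Type*} (p : σ) : Module.End ℂ (MvPolynomial σ ℂ) := (pderiv (R := ℂ) p).toLinearMap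

/-! ### Relations of the Weyl algebra -/

section Weyl

variable {σ : Type*}

@[simp] lemma mulX_apply (p : σ) (f : MvPolynomial σ ℂ) : mulX p f = X p * f := rfl

@[simp] lemma dX_apply (p : σ) (f : MvPolynomial σ ℂ) : dX p f = pderiv p f := rfl

lemma mulX_comm (p q : σ) : mulX p * mulX q = mulX q * mulX p := by
  refine LinearMap.ext fun f => ?_
  simp only [Module.End.mul_apply, mulX_apply]
  ring

lemma dX_comm [DecidableEq σ] (p q : σ) : dX p * dX q = dX q * dX p := by
  have h : ⁅(pderiv p : Derivation ℂ (MvPolynomial σ ℂ) (MvPolynomial σ ℂ)),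
      (pderiv q : Derivation ℂ (MvPolynomial σ ℂ) (MvPolynomial σ ℂ))⁆ = 0 := by
    refine MvPolynomial.derivation_ext fun r => ?_
    rw [Derivation.commutator_apply]
    simp only [pderiv_X, Pi.single_apply]
    split_ifs <;> simp
  refine LinearMap.ext fun f => ?_
  have := congrArg (fun D => D f) h
  simpa [Derivation.commutator_apply, sub_eq_zero] using this

lemma dX_mulX [DecidableEq σ] (p q : σ) : dX p * mulX q = mulX q * dX p + if p = q then 1 else 0 := by
  refine LinearMap.ext fun f => ?_
  by_cases h : p = q
  · subst h; simp [Derivation.leibniz, add_comm]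
  · simp [Derivation.leibniz, h, pderiv_X_of_ne (Ne.symm h)]

lemma dX_mulX_of_ne [DecidableEq σ] {p q : σ} (h : p ≠ q) : dX p * mulX q = mulX q * dX p := by
  simp [dX_mulX, h]

/-- In a normally ordered product the derivatives can be paired with either multiplication; this
regrouping turns products of generators of one Lie algebra into products for the other. -/
lemma mulX_mul_dX_exchange [DecidableEq σ] {p q p' q' : σ} (h : q ≠ p') :
    mulX p * dX q * (mulX p' * dX q') = mulX p' * (mulX p * dX q') * dX q := by
  calc mulX p * dX q * (mulX p' * dX q') = mulX p * (dX q * mulX p') * dX q' := by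
        simp only [mul_assoc]
    _ = (mulX p * mulX p') * (dX q * dX q') := by rw [dX_mulX_of_ne h]; simp only [mul_assoc]
    _ = mulX p' * (mulX p * dX q') * dX q := by
        rw [mulX_comm p p', dX_comm q q']; simp only [mul_assoc]

lemma mulX_mul_dX_comm [DecidableEq σ] {p q p' q' : σ} (h : q ≠ p') (h' : q' ≠ p) :
    mulX p * dX q * (mulX p' * dX q') = mulX p' * dX q' * (mulX p * dX q) := by
  rw [mulX_mul_dX_exchange h, ← dX_mulX_of_ne h']
  simp only [mul_assoc]

end Weyl

lemma eSlot_eq (a b : Fin k) (i : Fin n) : eSlot a b i = mulX (a, i) * dX (b, i) := rfl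

lemma eTot_eq (a b : Fin k) : (eTot a b : Module.End ℂ (P k n)) = ∑ i, mulX (a, i) * dX (b, i) := rfl

/-- Conjugation of endomorphisms by the transposition of the variables. -/
def transEnd (k n : ℕ) : Module.End ℂ (P k n) ≃ₐ[ℂ] Module.End ℂ (P n k) :=
  (transpose k n).toLinearEquiv.conjAlgEquiv ℂ

lemma transpose_X (p : Fin k × Fin n) : transpose k n (X p) = X p.swap := by
  simp [transpose]

lemma transpose_monomial (d : Fin k × Fin n →₀ ℕ) (c : ℂ) :
    transpose k n (monomial d c) = monomial (d.mapDomain Prod.swap) c := by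
  simp [transpose, rename_monomial]

@[simp] lemma transpose_transpose (f : P k n) : transpose n k (transpose k n f) = f := by
  simp only [transpose, renameEquiv_apply, rename_rename]
  convert rename_id_apply f
  ext x <;> rfl

lemma transpose_apply_end (A : Module.End ℂ (P k n)) (f : P k n) :
    transpose k n (A f) = transEnd k n A (transpose k n f) := by
  simp [transEnd, LinearEquiv.conjAlgEquiv]

@[simp] lemma transEnd_transEnd (A : Module.End ℂ (P k n)) : transEnd n k (transEnd k n A) = A := by
  refine LinearMap.ext fun f => ?_
  have h := transpose_apply_end (transEnd k n A) (transpose k n f)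
  rw [transpose_transpose] at h
  rw [← h, ← transpose_apply_end, transpose_transpose]

lemma transEnd_mulX (p : Fin k × Fin n) : transEnd k n (mulX p) = mulX p.swap := by
  refine LinearMap.ext fun f => ?_
  obtain ⟨f, rfl⟩ := (transpose k n).surjective f
  rw [← transpose_apply_end]
  simp [transpose_X]

lemma transpose_pderiv (p : Fin k × Fin n) (f : P k n) :
    transpose k n (pderiv p f) = pderiv p.swap (transpose k n f) := by
  simp only [transpose, renameEquiv_apply]
  exact (pderiv_rename (Equiv.prodComm (Fin k) (Fin n)).injective p f).symm

lemma transEnd_dX (p : Fin k × Fin n) : transEnd k n (dX p) = dX p.swap := by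
  refine LinearMap.ext fun f => ?_
  obtain ⟨f, rfl⟩ := (transpose k n).surjective f
  rw [← transpose_apply_end]
  simp [transpose_pderiv]

/-- The bijection of exponents induced by the transposition. -/
def expSwap (k n : ℕ) : (Fin k × Fin n →₀ ℕ) ≃ (Fin n × Fin k →₀ ℕ) :=
  (Finsupp.domCongr (Equiv.prodComm (Fin k) (Fin n))).toEquiv

lemma transpose_monomial' (d : Fin k × Fin n →₀ ℕ) (c : ℂ) :
    transpose k n (monomial d c) = monomial (expSwap k n d) c := by
  rw [transpose_monomial]
  congr 1
  simp [expSwap, Finsupp.equivMapDomain_eq_mapDomain]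

lemma expSwap_apply (d : Fin k × Fin n →₀ ℕ) (i : Fin n) (a : Fin k) :
    expSwap k n d (i, a) = d (a, i) := by
  simp [expSwap]

lemma coeff_transpose (d : Fin k × Fin n →₀ ℕ) (f : P k n) :
    coeff (expSwap k n d) (transpose k n f) = coeff d f := by
  rw [← coeff_rename_mapDomain _ (Equiv.prodComm (Fin k) (Fin n)).injective f d]
  simp [expSwap, transpose, Finsupp.equivMapDomain_eq_mapDomain]

lemma transpose_dZ (i : Fin n) (u : Fn k n) (z : Fin n → ℂ) (l : Fin k → ℂ) :
    transpose k n (dZ i u z l) = dL i (dualize u) l z := by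
  unfold dZ dL
  -- An additive equivalence commutes with `finsum` without any finiteness of support, so only a
  -- reindexing of exponents remains.
  have h := (transpose k n).toAddEquiv.map_finsum (fun d : Fin k × Fin n →₀ ℕ =>
    monomial d (deriv (fun s : ℂ => coeff d (u (Function.update z i s) l)) (z i)))
  refine h.trans ?_
  rw [← finsum_comp_equiv (expSwap k n)]
  refine finsum_congr fun d => ?_
  refine (transpose_monomial' d _).trans ?_
  simp only [dualize, coeff_transpose]

@[simp] lemma dualize_dualize (u : Fn k n) : dualize (dualize u) = u := by
  funext z l
  simp [dualize]

end WeylAlgebra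

/-! ## Duality of the differential operators -/

section DifferentialOperators

variable {k n : ℕ}

lemma transEnd_eSlot (a b : Fin k) (i : Fin n) :
    transEnd k n (eSlot a b i) = mulX (i, a) * dX (i, b) := by
  rw [eSlot_eq, map_mul, transEnd_mulX, transEnd_dX]; rfl

/-- Normal ordering of a product of two generators in different rows. -/
lemma eSlot_mul_eSlot {i j : Fin k} (h : i ≠ j) (a b : Fin n) :
    (eSlot i j a * eSlot j i b : Module.End ℂ (P k n))
      = (mulX (i, a) * dX (i, b)) * (mulX (j, b) * dX (j, a))
        + if a = b then eSlot i i a else 0 := by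
  simp only [eSlot_eq]
  have h1 : (dX (j, a) * mulX (j, b) : Module.End ℂ (P k n))
      = mulX (j, b) * dX (j, a) + if a = b then 1 else 0 := by
    rw [dX_mulX]; simp
  have h2 : (dX (i, b) * mulX (j, b) : Module.End ℂ (P k n)) = mulX (j, b) * dX (i, b) :=
    dX_mulX_of_ne (by simp [h])
  have h3 := dX_comm (σ := Fin k × Fin n) (j, a) (i, b)
  have e1 : (mulX (i, a) * dX (j, a) * (mulX (j, b) * dX (i, b)) : Module.End ℂ (P k n))
      = mulX (i, a) * (dX (j, a) * mulX (j, b)) * dX (i, b) := by noncomm_ring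
  have e2 : (mulX (i, a) * dX (i, b) * (mulX (j, b) * dX (j, a)) : Module.End ℂ (P k n))
      = mulX (i, a) * (dX (i, b) * mulX (j, b)) * dX (j, a) := by noncomm_ring
  rw [e1, e2, h1, h2, mul_add, add_mul]
  refine congrArg₂ (· + ·) ?_ ?_
  · simp only [mul_assoc, h3]
  · split_ifs with hab
    · rw [mul_one, hab]
    · simp

/-- Both sides are double sums over the columns `a`, `b`. Normal ordering matches them term by term,
and the corrections on the diagonal `a = b` add up to `e_{ii}`. -/
lemma transEnd_casimir {i j : Fin n} (h : i ≠ j) :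
    transEnd k n (casimir i j) = eTot i j * eTot j i - eTot i i := by
  rw [eq_sub_iff_add_eq]
  simp only [casimir, map_sum, map_mul, transEnd_eSlot]
  simp only [eTot, Finset.sum_mul_sum, eSlot_mul_eSlot h, Finset.sum_add_distrib]
  simp

lemma casimirPlus_add_casimirMinus (i j : Fin n) :
    (casimirPlus i j + casimirMinus i j : Module.End ℂ (P k n)) = casimir i j := by
  have h : ∀ a : Fin k, (∑ b, eSlot a b i * eSlot b a j : Module.End ℂ (P k n))
      = eSlot a a i * eSlot a a j + (∑ b with a < b, eSlot a b i * eSlot b a j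
        + ∑ b with b < a, eSlot a b i * eSlot b a j) := by
    intro a
    rw [← Finset.sum_filter_add_sum_filter_not Finset.univ (fun b => a < b),
      ← Finset.sum_filter_add_sum_filter_not (Finset.univ.filter fun b => ¬ a < b) (fun b => b < a),
      Finset.filter_filter, Finset.filter_filter]
    have e1 : (Finset.univ.filter fun b : Fin k => ¬ a < b ∧ b < a) = Finset.univ.filter fun b => b < a := by
      ext b; simp; omega
    have e2 : (Finset.univ.filter fun b : Fin k => ¬ a < b ∧ ¬ b < a) = {a} := by
      ext b; simp; omega
    rw [e1, e2, Finset.sum_singleton]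
    abel
  have hs : (∑ a : Fin k, ∑ b : Fin k with b < a, eSlot a b i * eSlot b a j : Module.End ℂ (P k n))
      = ∑ a : Fin k, ∑ b : Fin k with a < b, eSlot b a i * eSlot a b j := by
    simp only [Finset.sum_filter]
    exact Finset.sum_comm
  rw [casimir, Finset.sum_congr rfl fun a _ => h a, Finset.sum_add_distrib, Finset.sum_add_distrib,
    hs, casimirPlus, casimirMinus, casimirZero]
  generalize (∑ a : Fin k, eSlot a a i * eSlot a a j : Module.End ℂ (P k n)) = S
  have hS : S = (1 / 2 : ℂ) • S + (1 / 2 : ℂ) • S := by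
    rw [← add_smul, add_halves, one_smul]
  rw [add_add_add_comm, ← hS]

/-- The sum runs over `a < b`, so normal ordering produces no correction here. -/
lemma transEnd_casimirPlus {i j : Fin n} (h : i ≠ j) :
    transEnd k n (casimirPlus i j)
      = (1 / 2 : ℂ) • (∑ a, eSlot i i a * eSlot j j a)
        + ∑ a : Fin k, ∑ b : Fin k with a < b, eSlot i j a * eSlot j i b := by
  simp only [casimirPlus, casimirZero, map_add, map_smul, map_sum, map_mul, transEnd_eSlot]
  refine congrArg₂ (· + ·) rfl ?_
  refine Finset.sum_congr rfl fun a _ => Finset.sum_congr rfl fun b hb => ?_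
  have hab : a ≠ b := (Finset.mem_filter.mp hb).2.ne
  rw [eSlot_mul_eSlot h, if_neg hab, add_zero]

lemma eSlot_diag_comm (i : Fin k) (a b : Fin n) :
    (eSlot i i a * eSlot i i b : Module.End ℂ (P k n)) = eSlot i i b * eSlot i i a := by
  by_cases hab : a = b
  · rw [hab]
  exact mulX_mul_dX_comm (by simp [hab]) (by simp [Ne.symm hab])

lemma eTot_sq (i : Fin k) :
    (eTot i i * eTot i i : Module.End ℂ (P k n))
      = (∑ a, eSlot i i a * eSlot i i a)
        + (2 : ℂ) • ∑ a : Fin n, ∑ b : Fin n with a < b, eSlot i i a * eSlot i i b := by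
  have h : ∀ a : Fin n, (∑ b, eSlot i i a * eSlot i i b : Module.End ℂ (P k n))
      = eSlot i i a * eSlot i i a + (∑ b with a < b, eSlot i i a * eSlot i i b
        + ∑ b with b < a, eSlot i i a * eSlot i i b) := by
    intro a
    rw [← Finset.sum_filter_add_sum_filter_not Finset.univ (fun b => a < b),
      ← Finset.sum_filter_add_sum_filter_not (Finset.univ.filter fun b => ¬ a < b) (fun b => b < a),
      Finset.filter_filter, Finset.filter_filter]
    have e1 : (Finset.univ.filter fun b : Fin n => ¬ a < b ∧ b < a) = Finset.univ.filter fun b => b < a := by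
      ext b; simp; omega
    have e2 : (Finset.univ.filter fun b : Fin n => ¬ a < b ∧ ¬ b < a) = {a} := by
      ext b; simp; omega
    rw [e1, e2, Finset.sum_singleton]
    abel
  have hs : (∑ a : Fin n, ∑ b : Fin n with b < a, eSlot i i a * eSlot i i b : Module.End ℂ (P k n))
      = ∑ a : Fin n, ∑ b : Fin n with a < b, eSlot i i a * eSlot i i b := by
    simp only [Finset.sum_filter]
    rw [Finset.sum_comm]
    refine Finset.sum_congr rfl fun a _ => Finset.sum_congr rfl fun b _ => ?_
    rw [eSlot_diag_comm]
  rw [eTot, Finset.sum_mul_sum, Finset.sum_congr rfl fun a _ => h a, Finset.sum_add_distrib,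
    Finset.sum_add_distrib, hs, two_smul]


/-- This is the part of the trigonometric operators that does not involve the parameters. On the
left, the terms `j ≠ i` of the first sum cancel the diagonal parts of the `Ω⁺`. On the right, the
term `j = i` of the last sum cancels the cross terms of `½ e_{ii}²`. Half the sum of the squares
`(e_{ii})_{(a)}²` and the terms `e_{ij} ⊗ e_{ji}` with `j ≠ i` survive on both sides. -/
lemma transEnd_trig_identity (i : Fin n) :
    transEnd k n ((1 / 2 : ℂ) • (∑ a : Fin k, eTot a a * eSlot a a i)
        - ∑ j : Fin n with j ≠ i, casimirPlus i j)
      = (1 / 2 : ℂ) • (eTot i i * eTot i i)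
        - ∑ j : Fin n, ∑ a : Fin k, ∑ b : Fin k with a < b, eSlot i j a * eSlot j i b := by
  have h1 : (∑ j : Fin n with j ≠ i, transEnd k n (casimirPlus i j))
      = ∑ j : Fin n with j ≠ i, ((1 / 2 : ℂ) • (∑ a, eSlot i i a * eSlot j j a)
        + ∑ a : Fin k, ∑ b : Fin k with a < b, eSlot i j a * eSlot j i b) :=
    Finset.sum_congr rfl fun j hj => transEnd_casimirPlus (Finset.mem_filter.mp hj).2.symm
  have h2 : (∑ a : Fin k, transEnd k n (eTot a a * eSlot a a i))
      = ∑ j : Fin n, ∑ a : Fin k, eSlot j j a * eSlot i i a := by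
    rw [Finset.sum_comm]
    refine Finset.sum_congr rfl fun a _ => ?_
    rw [map_mul, eTot, map_sum, transEnd_eSlot, Finset.sum_mul]
    refine Finset.sum_congr rfl fun j _ => ?_
    rw [transEnd_eSlot]; rfl
  have h3 : ∀ j : Fin n, j ≠ i → (∑ a : Fin k, eSlot j j a * eSlot i i a : Module.End ℂ (P n k))
      = ∑ a : Fin k, eSlot i i a * eSlot j j a := by
    intro j hj
    refine Finset.sum_congr rfl fun a _ => ?_
    exact mulX_mul_dX_comm (by simp [hj]) (by simp [hj.symm])
  have split : ∀ f : Fin n → Module.End ℂ (P n k), ∑ j, f j = f i + ∑ j with j ≠ i, f j := by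
    intro f
    rw [← Finset.add_sum_erase _ _ (Finset.mem_univ i)]
    congr 2
    ext j; simp
  rw [map_sub, map_smul, map_sum, map_sum, h1, h2, split (fun j => ∑ a, eSlot j j a * eSlot i i a),
    split (fun j => ∑ a : Fin k, ∑ b : Fin k with a < b, eSlot i j a * eSlot j i b),
    Finset.sum_congr rfl fun j hj => h3 j (Finset.mem_filter.mp hj).2, Finset.sum_add_distrib,
    ← Finset.smul_sum, eTot_sq]
  rw [smul_add, smul_add, smul_smul]
  norm_num
  abel

lemma dualize_ratKZ (κ : ℂ) (i : Fin n) (u : Fn k n) (z : Fin n → ℂ) (l : Fin k → ℂ) :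
    dualize (ratKZ κ i u) l z = ratDD κ i (dualize u) l z := by
  simp only [dualize, ratKZ, ratDD, map_sub, map_sum, map_smul, transpose_dZ, transpose_apply_end,
    transEnd_eSlot, ← eSlot_eq]
  refine congrArg₂ (· - ·) rfl (Finset.sum_congr rfl fun j hj => ?_)
  rw [transEnd_casimir (Finset.mem_filter.mp hj).2.symm]

/-- From `z_i / (z_i - z_j) = 1 + z_j / (z_i - z_j)` and `Ω⁺ + Ω⁻ = Ω`, each interaction term is
`Ω⁺` plus `z_j / (z_i - z_j)` times `Ω`. The second piece dualizes as in the rational case, the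
first by `transEnd_trig_identity`. -/
lemma dualize_trigKZ (κ : ℂ) (i : Fin n) (u : Fn k n) (z : Fin n → ℂ) (l : Fin k → ℂ)
    (hz : ∀ j, j ≠ i → z i ≠ z j) :
    dualize (trigKZ κ i u) l z = trigDD κ i (dualize u) l z := by
  set v := u z l with hv
  have key : trigKZ κ i u z l = (κ * z i) • dZ i u z l - ∑ a : Fin k, l a • eSlot a a i v
      + ((1 / 2 : ℂ) • (∑ a : Fin k, eTot a a * eSlot a a i)
        - ∑ j : Fin n with j ≠ i, casimirPlus i j : Module.End ℂ (P k n)) v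
      - ∑ j : Fin n with j ≠ i, (z j / (z i - z j)) • casimir i j v := by
    have h1 : ∀ j ∈ Finset.univ.filter (fun j => j ≠ i), (1 / (z i - z j)) •
        (z i • casimirPlus i j + z j • casimirMinus i j : Module.End ℂ (P k n)) v
        = casimirPlus i j v + (z j / (z i - z j)) • casimir i j v := by
      intro j hj
      have hne : z i - z j ≠ 0 := sub_ne_zero.mpr (hz j (Finset.mem_filter.mp hj).2)
      rw [← casimirPlus_add_casimirMinus]
      simp only [LinearMap.add_apply, LinearMap.smul_apply, smul_add, smul_smul]
      have e : 1 / (z i - z j) * z i = 1 + z j / (z i - z j) := by field_simp; ring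
      rw [e, add_smul, one_smul, one_div_mul_eq_div, add_assoc]
    have h2 : (∑ a : Fin k, ((l a • 1 - (1 / 2 : ℂ) • eTot a a) * eSlot a a i :
          Module.End ℂ (P k n)) v)
        = ∑ a : Fin k, l a • eSlot a a i v
          - ((1 / 2 : ℂ) • (∑ a : Fin k, eTot a a * eSlot a a i) : Module.End ℂ (P k n)) v := by
      rw [LinearMap.smul_apply, LinearMap.sum_apply, Finset.smul_sum, ← Finset.sum_sub_distrib]
      refine Finset.sum_congr rfl fun a _ => ?_
      simp
    rw [trigKZ, Finset.sum_congr rfl h1, h2, Finset.sum_add_distrib, LinearMap.sub_apply,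
      LinearMap.sum_apply]
    abel
  have hD : trigDD κ i (dualize u) l z
      = (κ * z i) • dL i (dualize u) l z - ∑ a : Fin k, l a • eSlot i i a (dualize u l z)
      + ((1 / 2 : ℂ) • (eTot i i * eTot i i)
        - ∑ j : Fin n, ∑ a : Fin k, ∑ b : Fin k with a < b, eSlot i j a * eSlot j i b :
          Module.End ℂ (P n k)) (dualize u l z)
      - ∑ j : Fin n with j ≠ i, (z j / (z i - z j)) •
        (eTot i j * eTot j i - eTot i i : Module.End ℂ (P n k)) (dualize u l z) := by
    rw [trigDD]
    simp only [LinearMap.sub_apply, LinearMap.sum_apply, LinearMap.smul_apply]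
    abel
  rw [hD, ← transEnd_trig_identity]
  simp only [dualize]
  rw [key]
  rw [map_sub, map_add, map_sub, map_smul, transpose_dZ, transpose_apply_end, map_sum, map_sum]
  refine congrArg₂ (· - ·) (congrArg₂ (· + ·) (congrArg₂ (· - ·) rfl ?_) rfl) ?_
  · refine Finset.sum_congr rfl fun a _ => ?_
    rw [map_smul, transpose_apply_end, transEnd_eSlot]; rfl
  · refine Finset.sum_congr rfl fun j hj => ?_
    rw [map_smul, transpose_apply_end, transEnd_casimir (Finset.mem_filter.mp hj).2.symm]

/-- This is the KZ identity with `k` and `n` exchanged, applied to the dual function and transposed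
back. -/
lemma dualize_ratDD (κ : ℂ) (a : Fin k) (u : Fn k n) (z : Fin n → ℂ) (l : Fin k → ℂ) :
    dualize (ratDD κ a u) l z = ratKZ κ a (dualize u) l z := by
  have h := dualize_ratKZ κ a (dualize u) l z
  rw [dualize_dualize] at h
  simp only [dualize] at h ⊢
  rw [← h, transpose_transpose]

lemma dualize_trigDD (κ : ℂ) (a : Fin k) (u : Fn k n) (z : Fin n → ℂ) (l : Fin k → ℂ)
    (hl : ∀ b, b ≠ a → l a ≠ l b) :
    dualize (trigDD κ a u) l z = trigKZ κ a (dualize u) l z := by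
  have h := dualize_trigKZ κ a (dualize u) l z hl
  rw [dualize_dualize] at h
  simp only [dualize] at h ⊢
  rw [← h, transpose_transpose]

end DifferentialOperators

/-! ## Weights and the series `B_{ab}(t)` -/

section Weights

variable {k n : ℕ}

/-- The `ℤ^k`-grading of `P k n` by the total degrees in the rows of variables. -/
def rowWt (k n : ℕ) (p : Fin k × Fin n) : Fin k → ℤ := Pi.single p.1 1

/-- `f` has degree `r a` in the variables of the row `a`, for every `a`. -/
abbrev IsWt (r : Fin k → ℤ) (f : P k n) : Prop := IsWeightedHomogeneous (rowWt k n) f r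

lemma weight_rowWt (d : Fin k × Fin n →₀ ℕ) (a : Fin k) :
    Finsupp.weight (rowWt k n) d a = ∑ i, (d (a, i) : ℤ) := by
  rw [Finsupp.weight_apply, Finsupp.sum_fintype _ _ (by simp), Finset.sum_apply,
    Fintype.sum_prod_type]
  rw [Finset.sum_eq_single a]
  · simp [rowWt]
  · intro b _ hb
    simp [rowWt, hb.symm]
  · simp

lemma wt_eq (a : Fin k) (d : Fin k × Fin n →₀ ℕ) :
    wt a d = ((Finsupp.weight (rowWt k n) d a : ℤ) : ℂ) := by
  rw [weight_rowWt]; simp [wt]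

lemma isWt_monomial (d : Fin k × Fin n →₀ ℕ) (c : ℂ) :
    IsWt (Finsupp.weight (rowWt k n) d) (monomial d c) :=
  isWeightedHomogeneous_monomial _ _ _ rfl

namespace IsWt

variable {r : Fin k → ℤ} {f : P k n}

/-- Integer-valued weights may become negative under lowering, and there are no vectors of such
weight. This makes the series `B` finite on every vector and kills its last boundary term. -/
lemma eq_zero_of_neg (hf : IsWt r f) {a : Fin k} (ha : r a < 0) : f = 0 := by
  by_contra hne
  obtain ⟨d, hd⟩ := MvPolynomial.ne_zero_iff.mp hne
  have h := congrFun (hf hd) a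
  rw [weight_rowWt] at h
  have : (0 : ℤ) ≤ ∑ i, (d (a, i) : ℤ) := Finset.sum_nonneg fun _ _ => by positivity
  omega

lemma smul (c : ℂ) (hf : IsWt r f) : IsWt r (c • f) :=
  (weightedHomogeneousSubmodule ℂ (rowWt k n) r).smul_mem c hf

lemma mulX_mem (hf : IsWt r f) (p : Fin k × Fin n) : IsWt (r + Pi.single p.1 1) (mulX p f) := by
  rw [add_comm]
  exact (isWeightedHomogeneous_X ℂ (rowWt k n) p).mul hf

lemma dX_mem (hf : IsWt r f) (p : Fin k × Fin n) : IsWt (r - Pi.single p.1 1) (dX p f) :=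
  IsWeightedHomogeneous.pderiv hf (by simp [rowWt])

lemma eTot_mem (hf : IsWt r f) (a b : Fin k) :
    IsWt (r + (Pi.single a 1 - Pi.single b 1)) (eTot a b f) := by
  rw [eTot_eq, LinearMap.sum_apply]
  refine IsWeightedHomogeneous.sum _ _ _ fun i _ => ?_
  have h := (hf.dX_mem (b, i)).mulX_mem (a, i)
  rwa [show r + (Pi.single a 1 - Pi.single b 1) = r - Pi.single b 1 + Pi.single a 1 by abel]

lemma eTot_pow_mem (hf : IsWt r f) (a b : Fin k) (s : ℕ) :
    IsWt (r + s • (Pi.single a 1 - Pi.single b 1)) ((eTot a b ^ s) f) := by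
  induction s with
  | zero => simpa using hf
  | succ s ih =>
    rw [pow_succ', Module.End.mul_apply, succ_nsmul, ← add_assoc]
    exact ih.eTot_mem a b

lemma eTot_pow_mul_mem (hf : IsWt r f) (a b : Fin k) (s : ℕ) :
    IsWt r ((eTot b a ^ s * eTot a b ^ s : Module.End ℂ (P k n)) f) := by
  have h := (hf.eTot_pow_mem a b s).eTot_pow_mem b a s
  rw [add_assoc, ← smul_add] at h
  simpa using h

lemma eTot_pow_eq_zero (hf : IsWt r f) {a b : Fin k} (hab : a ≠ b) {s : ℕ} (hs : r b < s) :
    (eTot a b ^ s) f = 0 := by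
  refine (hf.eTot_pow_mem a b s).eq_zero_of_neg (a := b) ?_
  simp [hab.symm]
  omega

end IsWt

/-- The coefficient `∏_{j=1}^s 1 / (j (x - j))`. -/
def dynCoeff (x : ℂ) (s : ℕ) : ℂ := ∏ j ∈ Finset.Icc 1 s, 1 / ((j : ℂ) * (x - (j : ℂ)))

@[simp] lemma dynCoeff_zero (x : ℂ) : dynCoeff x 0 = 1 := by simp [dynCoeff]

/-- The ratio of consecutive coefficients, in the form needed for the telescoping in
`dynB_mul_intertwinerSource`. -/
lemma dynCoeff_succ (x : ℂ) (s : ℕ) (hx : x - (s + 1 : ℕ) ≠ 0) :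
    dynCoeff x (s + 1) * (((s + 1 : ℕ) : ℂ) * (x - (s + 1 : ℕ))) = dynCoeff x s := by
  have h : ((s + 1 : ℕ) : ℂ) ≠ 0 := Nat.cast_ne_zero.mpr (Nat.succ_ne_zero s)
  rw [dynCoeff, Finset.prod_Icc_succ_top (by omega), mul_assoc, one_div_mul_cancel
    (mul_ne_zero h hx), mul_one, dynCoeff]

lemma dynB_monomial {a b : Fin k} (hab : a ≠ b) (t : ℂ) (d : Fin k × Fin n →₀ ℕ) {N : ℕ}
    (hN : Finsupp.weight (rowWt k n) d b < N) :
    dynB a b t (monomial d 1) = ∑ s ∈ Finset.range N, dynCoeff (t - wt a d + wt b d) s •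
      (eTot b a ^ s * eTot a b ^ s : Module.End ℂ (P k n)) (monomial d 1) := by
  have h := (basisMonomials (Fin k × Fin n) ℂ).constr_basis ℂ (fun d =>
    ∑ᶠ s : ℕ, (∏ j ∈ Finset.Icc 1 s, 1 / ((j : ℂ) * (t - wt a d + wt b d - (j : ℂ)))) •
      (eTot b a ^ s * eTot a b ^ s : Module.End ℂ (P k n)) (monomial d (1 : ℂ))) d
  rw [coe_basisMonomials] at h
  refine h.trans (finsum_eq_sum_of_support_subset _ fun s hs => ?_)
  by_contra hsN
  rw [Finset.mem_coe, Finset.mem_range, not_lt] at hsN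
  apply hs
  simp only [Module.End.mul_apply]
  rw [(isWt_monomial d 1).eTot_pow_eq_zero hab (by omega), map_zero, smul_zero]

lemma mem_of_isWeightedHomogeneous {σ M : Type*} [AddCommMonoid M] {w : σ → M} {m : M}
    {f : MvPolynomial σ ℂ} (hf : IsWeightedHomogeneous w f m)
    {S : Submodule ℂ (MvPolynomial σ ℂ)}
    (h : ∀ d, Finsupp.weight w d = m → monomial d (1 : ℂ) ∈ S) : f ∈ S := by
  rw [f.as_sum]
  refine S.sum_mem fun d hd => ?_
  rw [← mul_one (coeff d f), ← smul_eq_mul, ← smul_monomial]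
  exact S.smul_mem _ (h d (hf (mem_support_iff.mp hd)))

lemma IsWt.linearMap_ext {r : Fin k → ℤ} {f : P k n} (hf : IsWt r f) {A B : Module.End ℂ (P k n)}
    (h : ∀ d, Finsupp.weight (rowWt k n) d = r → A (monomial d 1) = B (monomial d 1)) :
    A f = B f :=
  mem_of_isWeightedHomogeneous hf (S := LinearMap.eqLocus A B) h

/-- On one weight space the coefficients of the series are scalars. The cut-off `N` is left free so
that series applied to different vectors can be compared term by term. -/
lemma IsWt.dynB_apply {r : Fin k → ℤ} {f : P k n} (hf : IsWt r f) {a b : Fin k} (hab : a ≠ b)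
    (t : ℂ) {N : ℕ} (hN : r b < N) :
    dynB a b t f = ∑ s ∈ Finset.range N, dynCoeff (t - r a + r b) s •
      (eTot b a ^ s * eTot a b ^ s : Module.End ℂ (P k n)) f := by
  have h := hf.linearMap_ext (A := dynB a b t)
    (B := ∑ s ∈ Finset.range N, dynCoeff (t - r a + r b) s •
      (eTot b a ^ s * eTot a b ^ s)) fun d hd => by
    rw [dynB_monomial hab t d (N := N) (by rw [hd]; exact hN), wt_eq, wt_eq, hd]
    simp [LinearMap.sum_apply]
  rw [h]
  simp [LinearMap.sum_apply]

lemma IsWt.dynB_mem {r : Fin k → ℤ} {f : P k n} (hf : IsWt r f) {a b : Fin k} (hab : a ≠ b)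
    (t : ℂ) : IsWt r (dynB a b t f) := by
  rw [hf.dynB_apply hab t (N := (r b).toNat + 1) (by omega)]
  exact IsWeightedHomogeneous.sum _ _ _ fun s _ => (hf.eTot_pow_mul_mem a b s).smul _

lemma end_ext {A B : Module.End ℂ (P k n)} (h : ∀ d, A (monomial d 1) = B (monomial d 1)) :
    A = B :=
  (basisMonomials (Fin k × Fin n) ℂ).ext fun d => by simpa using h d

@[simp] lemma weightOp_monomial (f : (Fin k × Fin n →₀ ℕ) → ℂ) (d : Fin k × Fin n →₀ ℕ) :
    weightOp f (monomial d 1) = f d • monomial d 1 := by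
  have h := (basisMonomials (Fin k × Fin n) ℂ).constr_basis ℂ (fun d => f d • monomial d (1 : ℂ)) d
  rwa [coe_basisMonomials] at h

lemma weightOp_mul (f g : (Fin k × Fin n →₀ ℕ) → ℂ) :
    weightOp f * weightOp g = weightOp (fun d => f d * g d) := by
  refine end_ext fun d => ?_
  rw [Module.End.mul_apply, weightOp_monomial, weightOp_monomial, map_smul, weightOp_monomial,
    smul_smul, mul_comm]

lemma weightOp_one : weightOp (fun _ : Fin k × Fin n →₀ ℕ => 1) = 1 :=
  end_ext fun d => by simp

lemma isUnit_weightOp {f : (Fin k × Fin n →₀ ℕ) → ℂ} (hf : ∀ d, f d ≠ 0) :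
    IsUnit (weightOp f) := by
  refine ⟨⟨weightOp f, weightOp fun d => (f d)⁻¹, ?_, ?_⟩, rfl⟩
  · rw [weightOp_mul, ← weightOp_one]; simp [hf]
  · rw [weightOp_mul, ← weightOp_one]; simp [hf]

lemma IsWt.weightOp_apply {r : Fin k → ℤ} {f : P k n} (hf : IsWt r f)
    (g : (Fin k → ℤ) → ℂ) :
    weightOp (fun d => g (Finsupp.weight (rowWt k n) d)) f = g r • f := by
  have h := hf.linearMap_ext (A := weightOp (fun d => g (Finsupp.weight (rowWt k n) d)))
    (B := g r • 1) fun d hd => by simp [hd]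
  simpa using h

/-- `B` preserves the row weights, on which the function is constant. -/
lemma weightOp_comm_dynB (g : (Fin k → ℤ) → ℂ) {a b : Fin k} (hab : a ≠ b) (t : ℂ) :
    weightOp (fun d => g (Finsupp.weight (rowWt k n) d)) * dynB a b t
      = dynB a b t * weightOp (fun d => g (Finsupp.weight (rowWt k n) d)) := by
  refine end_ext fun d => ?_
  have h := isWt_monomial (k := k) (n := n) d 1
  rw [Module.End.mul_apply, Module.End.mul_apply, h.weightOp_apply, (h.dynB_mem hab t).weightOp_apply,
    map_smul]

end Weights

/-! ## Commutation relations and the intertwining property of `B_{ab}(t)` -/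

section Commutation

variable {k n : ℕ}

lemma eTot_mul_mulX (a b c : Fin k) (i : Fin n) :
    (eTot a b * mulX (c, i) : Module.End ℂ (P k n))
      = mulX (c, i) * eTot a b + if b = c then mulX (a, i) else 0 := by
  have h : ∀ j : Fin n, (mulX (a, j) * dX (b, j) * mulX (c, i) : Module.End ℂ (P k n))
      = mulX (c, i) * (mulX (a, j) * dX (b, j)) + if j = i then if b = c then mulX (a, i) else 0
        else 0 := by
    intro j
    rw [mul_assoc, dX_mulX, mul_add, ← mul_assoc, mulX_comm, mul_assoc]
    refine congrArg₂ (· + ·) rfl ?_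
    simp only [Prod.mk.injEq]
    by_cases h1 : j = i <;> by_cases h2 : b = c <;> simp [h1, h2]
  rw [eTot_eq, Finset.sum_mul, Finset.sum_congr rfl fun j _ => h j, Finset.sum_add_distrib,
    Finset.mul_sum]
  simp

lemma dX_mul_eTot (a b c : Fin k) (i : Fin n) :
    (dX (c, i) * eTot a b : Module.End ℂ (P k n))
      = eTot a b * dX (c, i) + if c = a then dX (b, i) else 0 := by
  have h : ∀ j : Fin n, (dX (c, i) * (mulX (a, j) * dX (b, j)) : Module.End ℂ (P k n))
      = mulX (a, j) * dX (b, j) * dX (c, i) + if j = i then if c = a then dX (b, i) else 0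
        else 0 := by
    intro j
    rw [← mul_assoc, dX_mulX, add_mul, mul_assoc, dX_comm, ← mul_assoc]
    refine congrArg₂ (· + ·) rfl ?_
    simp only [Prod.mk.injEq]
    by_cases h1 : j = i <;> by_cases h2 : c = a <;> simp [h1, h2, eq_comm (a := i)]
  rw [eTot_eq, Finset.mul_sum, Finset.sum_congr rfl fun j _ => h j, Finset.sum_add_distrib,
    Finset.sum_mul]
  simp

/-- The commutation relations of `gl_k`. -/
lemma eTot_mul_eTot (a b c d : Fin k) :
    (eTot a b * eTot c d : Module.End ℂ (P k n))
      = eTot c d * eTot a b + (if b = c then eTot a d else 0) - if d = a then eTot c b else 0 := by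
  have h : ∀ i : Fin n, (eTot a b * (mulX (c, i) * dX (d, i)) : Module.End ℂ (P k n))
      = mulX (c, i) * dX (d, i) * eTot a b + (if b = c then mulX (a, i) * dX (d, i) else 0)
        - if d = a then mulX (c, i) * dX (b, i) else 0 := by
    intro i
    have h1 := dX_mul_eTot (k := k) a b d i
    rw [← mul_assoc, eTot_mul_mulX, add_mul, mul_assoc, mul_assoc, h1, mul_add]
    split_ifs <;> noncomm_ring
  rw [eTot_eq c d, Finset.mul_sum, Finset.sum_congr rfl fun i _ => h i, Finset.sum_sub_distrib,
    Finset.sum_add_distrib, Finset.sum_mul]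
  refine congrArg₂ (· - ·) (congrArg₂ (· + ·) rfl ?_) ?_ <;> split_ifs <;> simp [eTot_eq]

lemma IsWt.eTot_self {r : Fin k → ℤ} {f : P k n} (hf : IsWt r f) (a : Fin k) :
    eTot a a f = (r a : ℂ) • f := by
  have h := hf.linearMap_ext (A := eTot a a) (B := (r a : ℂ) • 1) fun d hd => by
    rw [eTot_eq, LinearMap.sum_apply, LinearMap.smul_apply, Module.End.one_apply, ← hd,
      weight_rowWt, Int.cast_sum, Finset.sum_smul]
    refine Finset.sum_congr rfl fun i _ => ?_
    rw [Module.End.mul_apply, mulX_apply, dX_apply, X_mul_pderiv_monomial, Int.cast_natCast,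
      Nat.cast_smul_eq_nsmul]
  simpa using h

lemma end_pow_succ_apply {M : Type*} [AddCommMonoid M] [Module ℂ M] (A : Module.End ℂ M) (s : ℕ)
    (f : M) : (A ^ (s + 1)) f = A ((A ^ s) f) := by
  rw [pow_succ']; rfl

/-! ### The `sl_2` relations and the telescoping identity -/

section Intertwining

variable {i j : Fin k} {r : Fin k → ℤ} {f : P k n}

lemma IsWt.eTot_eTot (hf : IsWt r f) (i j : Fin k) :
    eTot i j (eTot j i f) = eTot j i (eTot i j f) - ((r j - r i : ℤ) : ℂ) • f := by
  have h := congrArg (fun A => A f) (eTot_mul_eTot (n := n) i j j i)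
  simp only [Module.End.mul_apply, LinearMap.add_apply, LinearMap.sub_apply, if_true,
    hf.eTot_self] at h
  rw [h]
  push_cast
  module

/-- The standard commutator of a power of a raising operator with the lowering operator of an
`sl_2`-triple, where `h` acts by `r i - r j`. -/
lemma IsWt.eTot_pow_eTot (hf : IsWt r f) (hij : i ≠ j) (s : ℕ) :
    (eTot i j ^ (s + 1)) (eTot j i f) = eTot j i ((eTot i j ^ (s + 1)) f)
      - ((s + 1) * ((r j - r i : ℤ) - s) : ℂ) • (eTot i j ^ s) f := by
  induction s with
  | zero => simp [hf.eTot_eTot i j]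
  | succ s ih =>
    rw [end_pow_succ_apply, ih, map_sub, map_smul,
      (hf.eTot_pow_mem i j (s + 1)).eTot_eTot i j, ← end_pow_succ_apply _ s,
      ← end_pow_succ_apply _ (s + 1)]
    simp [hij, hij.symm]
    module

lemma IsWt.eTot_eTot_pow (hf : IsWt r f) (hij : i ≠ j) (s : ℕ) :
    eTot i j ((eTot j i ^ (s + 1)) f) = (eTot j i ^ (s + 1)) (eTot i j f)
      - ((s + 1) * ((r j - r i : ℤ) + s) : ℂ) • (eTot j i ^ s) f := by
  induction s with
  | zero => simp [hf.eTot_eTot i j]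
  | succ s ih =>
    rw [end_pow_succ_apply _ (s + 1), (hf.eTot_pow_mem j i (s + 1)).eTot_eTot i j, ih, map_sub,
      map_smul, ← end_pow_succ_apply _ s, ← end_pow_succ_apply _ (s + 1)]
    simp [hij, hij.symm]
    module

lemma eTot_pow_mulX_of_ne {i j c : Fin k} (h : i ≠ c) (a : Fin n) (s : ℕ) (f : P k n) :
    (eTot j i ^ s) (mulX (c, a) f) = mulX (c, a) ((eTot j i ^ s) f) := by
  have h0 : Commute (eTot j i : Module.End ℂ (P k n)) (mulX (c, a)) := by
    rw [commute_iff_eq, eTot_mul_mulX, if_neg h, add_zero]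
  exact congrArg (fun A => A f) (h0.pow_left s).eq

lemma eTot_pow_mulX (hij : i ≠ j) (a : Fin n) (s : ℕ) (f : P k n) :
    (eTot j i ^ (s + 1)) (mulX (i, a) f) = mulX (i, a) ((eTot j i ^ (s + 1)) f)
      + (s + 1 : ℂ) • mulX (j, a) ((eTot j i ^ s) f) := by
  have h1 : ∀ g : P k n, eTot j i (mulX (i, a) g) = mulX (i, a) (eTot j i g) + mulX (j, a) g := by
    intro g
    have := congrArg (fun A => A g) (eTot_mul_mulX j i i a)
    simpa only [Module.End.mul_apply, LinearMap.add_apply, if_true] using this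
  have h2 : ∀ g : P k n, eTot j i (mulX (j, a) g) = mulX (j, a) (eTot j i g) := by
    intro g
    simpa using eTot_pow_mulX_of_ne (j := j) hij a 1 g
  induction s with
  | zero => simpa using h1 f
  | succ s ih =>
    rw [end_pow_succ_apply, ih, map_add, map_smul, h1, h2, ← end_pow_succ_apply _ s,
      ← end_pow_succ_apply _ (s + 1)]
    push_cast
    module

lemma dX_eTot_pow_of_ne {i j c : Fin k} (h : c ≠ i) (a : Fin n) (s : ℕ) (f : P k n) :
    dX (c, a) ((eTot i j ^ s) f) = (eTot i j ^ s) (dX (c, a) f) := by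
  have h0 : Commute (dX (c, a)) (eTot i j : Module.End ℂ (P k n)) := by
    rw [commute_iff_eq, dX_mul_eTot, if_neg h, add_zero]
  exact congrArg (fun A => A f) (h0.pow_right s).eq

lemma dX_eTot_pow (hij : i ≠ j) (a : Fin n) (s : ℕ) (f : P k n) :
    dX (i, a) ((eTot i j ^ (s + 1)) f) = (eTot i j ^ (s + 1)) (dX (i, a) f)
      + (s + 1 : ℂ) • (eTot i j ^ s) (dX (j, a) f) := by
  have h1 : ∀ g : P k n, dX (i, a) (eTot i j g) = eTot i j (dX (i, a) g) + dX (j, a) g := by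
    intro g
    have := congrArg (fun A => A g) (dX_mul_eTot i j i a)
    simpa only [Module.End.mul_apply, LinearMap.add_apply, if_true] using this
  induction s with
  | zero => simpa using h1 f
  | succ s ih =>
    rw [end_pow_succ_apply _ (s + 1), h1, ih, map_add, map_smul, ← end_pow_succ_apply _ s,
      ← end_pow_succ_apply _ (s + 1), dX_eTot_pow_of_ne hij.symm]
    push_cast
    module

/-- The operator `t y_a ∂_{y_b} + ∑_c y_a ∂_{y_c} w_c ∂_{w_b}`, where `y` and `w` are the rows `i`
and `j` of variables. -/
def intertwinerSource (i j : Fin k) (t : ℂ) (a b : Fin n) : Module.End ℂ (P k n) :=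
  t • (mulX (i, a) * dX (i, b)) + mulX (i, a) * eTot j i * dX (j, b)

/-- The operator `t y_a ∂_{y_b} + ∑_c y_c ∂_{y_b} w_a ∂_{w_c}`, where `y` and `w` are the rows `i`
and `j` of variables. -/
def intertwinerTarget (i j : Fin k) (t : ℂ) (a b : Fin n) : Module.End ℂ (P k n) :=
  t • (mulX (i, a) * dX (i, b)) + mulX (j, a) * eTot i j * dX (i, b)

lemma IsWt.intertwinerSource_mem (hf : IsWt r f) (i j : Fin k) (t : ℂ) (a b : Fin n) :
    IsWt r (intertwinerSource i j t a b f) := by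
  have h1 := ((hf.dX_mem (i, b)).mulX_mem (i, a)).smul t
  have h2 := ((hf.dX_mem (j, b)).eTot_mem j i).mulX_mem (i, a)
  rw [show r - Pi.single (j, b).1 1 + (Pi.single j 1 - Pi.single i 1) + Pi.single (i, a).1 1 = r by
    simp] at h2
  rw [show r - Pi.single (i, b).1 1 + Pi.single (i, a).1 1 = r by simp] at h1
  exact h1.add h2

/-- The boundary term of the telescoping sum in `dynB_mul_intertwinerSource`. -/
def intertwinerBoundary (i j : Fin k) (a b : Fin n) (s : ℕ) (f : P k n) : P k n :=
  mulX (i, a) ((eTot j i ^ (s + 1)) ((eTot i j ^ s) (dX (j, b) f)))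
    - mulX (j, a) ((eTot j i ^ s) ((eTot i j ^ (s + 1)) (dX (i, b) f)))

lemma intertwiner_zero (i j : Fin k) (t : ℂ) (a b : Fin n) :
    intertwinerSource i j t a b f - intertwinerTarget i j t a b f
      = intertwinerBoundary i j a b 0 f := by
  simp only [intertwinerSource, intertwinerTarget, intertwinerBoundary, LinearMap.add_apply,
    LinearMap.smul_apply, Module.End.mul_apply, zero_add, pow_one, pow_zero, Module.End.one_apply]
  abel

/-- The summand `e_{ji}^{s+1} e_{ij}^{s+1}` fails to intertwine source and target by a combination
of two consecutive boundary terms. The factor `(s+1)(t + r_j - r_i - (s+1))` is the ratio of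
consecutive coefficients of `B_{ij}(t)` on weight `r`, so the failures cancel in the series. -/
lemma IsWt.intertwiner_succ (hf : IsWt r f) (hij : i ≠ j) (t : ℂ) (a b : Fin n) (s : ℕ) :
    (eTot j i ^ (s + 1)) ((eTot i j ^ (s + 1)) (intertwinerSource i j t a b f))
        - intertwinerTarget i j t a b ((eTot j i ^ (s + 1)) ((eTot i j ^ (s + 1)) f))
      = intertwinerBoundary i j a b (s + 1) f
        - ((s + 1) * (t + (r j - r i : ℤ) - (s + 1)) : ℂ) • intertwinerBoundary i j a b s f := by
  have hdw := hf.dX_mem (j, b)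
  have hdy := hf.dX_mem (i, b)
  simp only [intertwinerSource, intertwinerTarget, LinearMap.add_apply, LinearMap.smul_apply,
    Module.End.mul_apply]
  rw [dX_eTot_pow_of_ne hij, dX_eTot_pow hij, map_add (eTot i j ^ (s + 1)), map_smul,
    eTot_pow_mulX_of_ne hij.symm, eTot_pow_mulX_of_ne hij.symm,
    hdw.eTot_pow_eTot hij s]
  -- `M` is `∂_{y_b} e_{ij}^{s+1} f`. Keeping it as a single vector of definite weight allows
  -- `e_{ij}` to be moved past `e_{ji}^{s+1}` by `eTot_eTot_pow`.
  set M := (eTot i j ^ (s + 1)) (dX (i, b) f) + (s + 1 : ℂ) • (eTot i j ^ s) (dX (j, b) f) with hM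
  have hMw : IsWt (r - Pi.single i 1 + (s + 1) • (Pi.single i 1 - Pi.single j 1)) M := by
    refine (hdy.eTot_pow_mem i j (s + 1)).add ?_
    have := (hdw.eTot_pow_mem i j s).smul (s + 1 : ℂ)
    rwa [show r - Pi.single (j, b).1 1 + s • (Pi.single i 1 - Pi.single j 1)
      = r - Pi.single i 1 + (s + 1) • (Pi.single i 1 - Pi.single j 1) by
        rw [succ_nsmul]; abel] at this
  rw [hMw.eTot_eTot_pow hij s, map_add (eTot j i ^ (s + 1)), map_smul, eTot_pow_mulX hij,
    eTot_pow_mulX hij]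
  have hF : eTot i j M = (eTot i j ^ (s + 2)) (dX (i, b) f)
      + (s + 1 : ℂ) • (eTot i j ^ (s + 1)) (dX (j, b) f) := by
    rw [hM, map_add, map_smul, ← end_pow_succ_apply, ← end_pow_succ_apply]
  have hE : ∀ (m : ℕ) (g : P k n), (eTot j i ^ m) (eTot j i g) = (eTot j i ^ (m + 1)) g :=
    fun m g => by rw [pow_succ]; rfl
  rw [hF, hM]
  simp only [intertwinerBoundary, map_add, map_sub, map_smul, hE]
  simp [hij, hij.symm, -mulX_apply, -dX_apply]
  module

/-- The series `B_{ij}(t)` intertwines the two families of operators. -/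
theorem dynB_mul_intertwinerSource (hij : i ≠ j) {t : ℂ} (ht : NotInt t) (a b : Fin n) :
    dynB i j t * intertwinerSource i j t a b = intertwinerTarget i j t a b * dynB i j t := by
  refine end_ext fun d => ?_
  have hf := isWt_monomial (k := k) (n := n) d 1
  set f : P k n := monomial d 1
  set r := Finsupp.weight (rowWt k n) d
  set N := (r j).toNat + 1 with hN
  set x : ℂ := t - r i + r j with hx
  rw [Module.End.mul_apply, Module.End.mul_apply,
    (hf.intertwinerSource_mem i j t a b).dynB_apply hij t (N := N) (by omega),
    hf.dynB_apply hij t (N := N) (by omega), map_sum, ← sub_eq_zero, ← Finset.sum_sub_distrib]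
  -- The terms up to `s = M` telescope to the boundary term at `M` alone.
  have key : ∀ M : ℕ, ∑ s ∈ Finset.range (M + 1),
      (dynCoeff x s • (eTot j i ^ s * eTot i j ^ s : Module.End ℂ (P k n))
          (intertwinerSource i j t a b f)
        - intertwinerTarget i j t a b
          (dynCoeff x s • (eTot j i ^ s * eTot i j ^ s : Module.End ℂ (P k n)) f))
      = dynCoeff x M • intertwinerBoundary i j a b M f := by
    intro M
    induction M with
    | zero => simpa using intertwiner_zero (f := f) i j t a b
    | succ M ih =>
      -- Non-integrality of `t` keeps the denominators of the series away from zero.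
      have hxM : x - (M + 1 : ℕ) ≠ 0 := by
        intro h
        refine ht (r i - r j + (M + 1 : ℕ)) ?_
        push_cast at h ⊢
        linear_combination h
      rw [Finset.sum_range_succ, ih, map_smul, ← smul_sub, Module.End.mul_apply,
        Module.End.mul_apply, hf.intertwiner_succ hij, ← dynCoeff_succ x M hxM, hx]
      push_cast
      module
  -- With `M = (r j).toNat` the boundary term vanishes: `e_{ij}^M` meets a vector of degree `r j -
  -- 1` in the row `j`, and `e_{ij}^{M+1}` one of degree `r j`.
  rw [hN, key, intertwinerBoundary, (hf.dX_mem (j, b)).eTot_pow_eq_zero hij,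
    (hf.dX_mem (i, b)).eTot_pow_eq_zero hij]
  · simp
  · simp [hij]
  · simp

/-- The actions of the two dual Lie algebras commute: the corrections from `c = j` and `c = i` are
both `x_{ia} ∂_{jb}`, with opposite signs. -/
lemma eTot_comm_colSum (i j : Fin k) (a b : Fin n) :
    (eTot i j * ∑ c : Fin k, mulX (c, a) * dX (c, b) : Module.End ℂ (P k n))
      = (∑ c : Fin k, mulX (c, a) * dX (c, b)) * eTot i j := by
  have h : ∀ c : Fin k, (eTot i j * (mulX (c, a) * dX (c, b)) : Module.End ℂ (P k n))
      = mulX (c, a) * dX (c, b) * eTot i j + (if j = c then mulX (i, a) * dX (c, b) else 0)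
        - if c = i then mulX (c, a) * dX (j, b) else 0 := by
    intro c
    have h1 := dX_mul_eTot (k := k) i j c b
    rw [← mul_assoc, eTot_mul_mulX, add_mul, mul_assoc, mul_assoc, h1, mul_add]
    split_ifs <;> noncomm_ring
  rw [Finset.mul_sum, Finset.sum_congr rfl fun c _ => h c, Finset.sum_sub_distrib,
    Finset.sum_add_distrib, Finset.sum_mul]
  simp

lemma IsWt.colSum_mem (hf : IsWt r f) (a b : Fin n) :
    IsWt r ((∑ c : Fin k, mulX (c, a) * dX (c, b) : Module.End ℂ (P k n)) f) := by
  rw [LinearMap.sum_apply]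
  refine IsWeightedHomogeneous.sum _ _ _ fun c _ => ?_
  have := (hf.dX_mem (c, b)).mulX_mem (c, a)
  rwa [sub_add_cancel] at this

/-- The dual Lie algebra commutes with `B_{ij}(t)`. -/
lemma dynB_mul_colSum (hij : i ≠ j) (t : ℂ) (a b : Fin n) :
    (dynB i j t * ∑ c : Fin k, mulX (c, a) * dX (c, b) : Module.End ℂ (P k n))
      = (∑ c : Fin k, mulX (c, a) * dX (c, b)) * dynB i j t := by
  refine end_ext fun d => ?_
  have hf := isWt_monomial (k := k) (n := n) d 1
  rw [Module.End.mul_apply, Module.End.mul_apply, (hf.colSum_mem a b).dynB_apply hij t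
    (N := (Finsupp.weight (rowWt k n) d j).toNat + 1) (by omega),
    hf.dynB_apply hij t (N := (Finsupp.weight (rowWt k n) d j).toNat + 1) (by omega), map_sum]
  refine Finset.sum_congr rfl fun s _ => ?_
  rw [map_smul]
  have h1 : Commute (eTot j i ^ s * eTot i j ^ s : Module.End ℂ (P k n))
      (∑ c : Fin k, mulX (c, a) * dX (c, b)) :=
    Commute.mul_left (Commute.pow_left (eTot_comm_colSum j i a b) s)
      (Commute.pow_left (eTot_comm_colSum i j a b) s)
  exact congrArg (fun A => dynCoeff _ s • A (monomial d (1 : ℂ))) h1.eq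

end Intertwining

end Commutation

/-! ## The normalization factor -/

section Normalization

open Polynomial in
/-- The Chu–Vandermonde identity for rising factorials. -/
lemma sum_choose_ascPochhammer (x y : ℂ) (q : ℕ) :
    ∑ s ∈ Finset.range (q + 1), (q.choose s : ℂ) *
      ((ascPochhammer ℂ s).eval x * (ascPochhammer ℂ (q - s)).eval y)
      = (ascPochhammer ℂ q).eval (x + y) := by
  rw [← Finset.Nat.sum_antidiagonal_eq_sum_range_succ (fun s m => (q.choose s : ℂ) *
    ((ascPochhammer ℂ s).eval x * (ascPochhammer ℂ m).eval y))]
  induction q with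
  | zero => simp
  | succ q ih =>
    -- Pascal's rule splits the sum in two; since `s + m = q`, the new factors `x + s` and `y + m`
    -- add up to `x + y + q`.
    rw [Finset.sum_antidiagonal_choose_succ_mul (fun s m => (ascPochhammer ℂ s).eval x *
      (ascPochhammer ℂ m).eval y), ascPochhammer_succ_eval, ← ih, Finset.sum_mul,
      ← Finset.sum_add_distrib]
    refine Finset.sum_congr rfl fun p hp => ?_
    have hpq := Finset.HasAntidiagonal.mem_antidiagonal.mp hp
    rw [ascPochhammer_succ_eval, ascPochhammer_succ_eval,
      ← Nat.choose_symm_of_eq_add (show q = p.1 + p.2 from hpq.symm), ← hpq]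
    push_cast
    ring

open Polynomial in
lemma Gamma_add_nat (z : ℂ) (hz : NotInt z) (q : ℕ) :
    Complex.Gamma (z + q) = Complex.Gamma z * (ascPochhammer ℂ q).eval z := by
  induction q with
  | zero => simp
  | succ q ih =>
    have h : z + q ≠ 0 := fun h => hz (-q) (by push_cast; linear_combination h)
    rw [ascPochhammer_succ_eval, ← mul_assoc, ← ih, Nat.cast_succ, ← add_assoc,
      Complex.Gamma_add_one _ h, mul_comm]

lemma NotInt.add_int {t : ℂ} (ht : NotInt t) (m : ℤ) : NotInt (t + m) := fun c hc =>
  ht (c - m) (by push_cast; linear_combination hc)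

lemma NotInt.neg {t : ℂ} (ht : NotInt t) : NotInt (-t) := fun c hc =>
  ht (-c) (by push_cast; linear_combination -hc)

lemma NotInt.Gamma_ne_zero {t : ℂ} (ht : NotInt t) : Complex.Gamma t ≠ 0 :=
  Complex.Gamma_ne_zero fun m h => ht (-m) (by push_cast; exact h)

open Polynomial in
lemma NotInt.ascPochhammer_ne_zero {t : ℂ} (ht : NotInt t) (q : ℕ) :
    (ascPochhammer ℂ q).eval t ≠ 0 := by
  have h := (ht.add_int q).Gamma_ne_zero
  rw [Int.cast_natCast, Gamma_add_nat t ht] at h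
  exact right_ne_zero_of_mul h

open Polynomial in
-- The denominator of the coefficient is `s!` times `(x+q-1) ⋯ (x+q-s)`, and these are the top `s`
-- factors of the rising factorial `(x)_q`.
lemma dynCoeff_mul_ascPochhammer {x : ℂ} (hx : NotInt x) (q : ℕ) {s : ℕ} (hs : s ≤ q) :
    dynCoeff (x + q) s * (s.factorial * (ascPochhammer ℂ q).eval x)
      = (ascPochhammer ℂ (q - s)).eval x := by
  induction s with
  | zero => simp
  | succ s ih =>
    have h1 := ih (by omega)
    have hne : x + q - (s + 1 : ℕ) ≠ 0 := by
      have := hx.add_int (q - (s + 1 : ℕ)) 0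
      push_cast at this ⊢
      rwa [add_sub_assoc]
    have hs' : q - s = (q - (s + 1)) + 1 := by omega
    rw [← dynCoeff_succ _ _ hne, hs', ascPochhammer_succ_eval, Nat.cast_sub hs] at h1
    have h2 : x + ((q : ℂ) - (s + 1 : ℕ)) ≠ 0 := by rwa [← add_sub_assoc]
    refine mul_right_cancel₀ h2 (Eq.trans ?_ h1)
    rw [Nat.factorial_succ]
    push_cast
    ring

variable {k n : ℕ}

lemma eTot_pow_X_pow {i j : Fin k} (hij : i ≠ j) (a : Fin n) (p q s : ℕ) :
    (eTot i j ^ s) (X (i, a) ^ p * X (j, a) ^ q : P k n)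
      = (q.descFactorial s : ℂ) • (X (i, a) ^ (p + s) * X (j, a) ^ (q - s)) := by
  have h1 : ∀ p q : ℕ, eTot i j (X (i, a) ^ p * X (j, a) ^ q : P k n)
      = (q : ℂ) • (X (i, a) ^ (p + 1) * X (j, a) ^ (q - 1)) := by
    intro p q
    rw [eTot_eq, LinearMap.sum_apply, Finset.sum_eq_single a]
    · have h0 : pderiv (j, a) (X (i, a) : P k n) = 0 := pderiv_X_of_ne (by simp [hij])
      simp only [Module.End.mul_apply, mulX_apply, dX_apply, Derivation.leibniz,
        Derivation.leibniz_pow, pderiv_X_self, h0, smul_eq_C_mul, smul_eq_mul, nsmul_eq_mul,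
        map_natCast]
      ring
    · intro c _ hc
      have h0 : pderiv (j, c) (X (i, a) : P k n) = 0 := pderiv_X_of_ne (by simp [hij])
      have h2 : pderiv (j, c) (X (j, a) : P k n) = 0 := pderiv_X_of_ne (by simp [hc.symm])
      simp [Derivation.leibniz, Derivation.leibniz_pow, h0, h2]
    · simp
  induction s with
  | zero => simp
  | succ s ih =>
    rw [end_pow_succ_apply, ih, map_smul, h1, smul_smul, Nat.descFactorial_succ, add_assoc,
      Nat.sub_sub]
    push_cast
    rw [mul_comm]

/-- The operator `C_{ij}(t) B_{ij}(t)`. -/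
def normalizedDynB (i j : Fin k) (t : ℂ) : Module.End ℂ (P k n) :=
  weightOp (cVal i j t) * dynB i j t

/-- The value of `C_{ij}(t)` on vectors of weight `r`. -/
def cWeight (i j : Fin k) (t : ℂ) (r : Fin k → ℤ) : ℂ :=
  Complex.Gamma (t + 1) * Complex.Gamma (t - r i + r j) /
    (Complex.Gamma (t - r i) * Complex.Gamma (t + r j + 1))

lemma cVal_eq (i j : Fin k) (t : ℂ) :
    cVal (n := n) i j t = fun d => cWeight i j t (Finsupp.weight (rowWt k n) d) := by
  funext d
  simp only [cVal, cWeight, wt_eq]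

lemma cVal_ne_zero (i j : Fin k) {t : ℂ} (ht : NotInt t) (d : Fin k × Fin n →₀ ℕ) :
    cVal i j t d ≠ 0 := by
  rw [cVal_eq]
  beta_reduce
  generalize Finsupp.weight (rowWt k n) d = r
  have h1 := (ht.add_int 1).Gamma_ne_zero
  have h2 := (ht.add_int (-r i + r j)).Gamma_ne_zero
  have h3 := (ht.add_int (-r i)).Gamma_ne_zero
  have h4 := (ht.add_int (r j + 1)).Gamma_ne_zero
  push_cast at h1 h2 h3 h4
  rw [cWeight, sub_eq_add_neg, add_assoc t _ (r j : ℂ), add_assoc t _ (1 : ℂ)]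
  exact div_ne_zero (mul_ne_zero h1 h2) (mul_ne_zero h3 h4)

lemma IsWt.normalizedDynB_apply {r : Fin k → ℤ} {f : P k n} (hf : IsWt r f) {i j : Fin k}
    (hij : i ≠ j) (t : ℂ) : normalizedDynB i j t f = cWeight i j t r • dynB i j t f := by
  rw [normalizedDynB, Module.End.mul_apply, cVal_eq, (hf.dynB_mem hij t).weightOp_apply]

lemma IsWt.normalizedDynB_mem {r : Fin k → ℤ} {f : P k n} (hf : IsWt r f) {i j : Fin k}
    (hij : i ≠ j) (t : ℂ) : IsWt r (normalizedDynB i j t f) := by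
  rw [hf.normalizedDynB_apply hij]
  exact (hf.dynB_mem hij t).smul _

/-- `C` is a scalar on each weight space, and `A` does not leave it, so both sides acquire the same
scalar. -/
lemma normalizedDynB_comm {i j : Fin k} (hij : i ≠ j) (t : ℂ) {A B : Module.End ℂ (P k n)}
    (hA : ∀ r f, IsWt r f → IsWt r (A f)) (h : dynB i j t * A = B * dynB i j t) :
    normalizedDynB i j t * A = B * normalizedDynB i j t := by
  refine end_ext fun d => ?_
  have hf := isWt_monomial (k := k) (n := n) d 1
  rw [Module.End.mul_apply, Module.End.mul_apply, hf.normalizedDynB_apply hij,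
    (hA _ _ hf).normalizedDynB_apply hij, map_smul]
  exact congrArg _ (congrArg (fun T => T (monomial d (1 : ℂ))) h)

open Polynomial in
-- Every term of the series acts on this vector by a scalar. By Chu–Vandermonde these scalars add up
-- to `(t+1)_q / (t-p)_q` in rising factorials, and `C_{ij}(t)` takes the reciprocal value; this is
-- the origin of the formula for `C`.
lemma normalizedDynB_X_pow {i j : Fin k} (hij : i ≠ j) {t : ℂ} (ht : NotInt t) (a : Fin n)
    (p q : ℕ) :
    normalizedDynB i j t (X (i, a) ^ p * X (j, a) ^ q : P k n) = X (i, a) ^ p * X (j, a) ^ q := by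
  set f : P k n := X (i, a) ^ p * X (j, a) ^ q with hfdef
  set r : Fin k → ℤ := p • Pi.single i 1 + q • Pi.single j 1 with hr
  have hf : IsWt r f := ((isWeightedHomogeneous_X ℂ (rowWt k n) (i, a)).pow p).mul
    ((isWeightedHomogeneous_X ℂ (rowWt k n) (j, a)).pow q)
  have hri : r i = p := by simp [hr, hij]
  have hrj : r j = q := by simp [hr, hij.symm]
  have hx : NotInt (t - p) := by simpa [sub_eq_add_neg] using ht.add_int (-p)
  have ht1 : NotInt (t + 1) := by simpa using ht.add_int 1
  have hc : cWeight i j t r = (ascPochhammer ℂ q).eval (t - p) / (ascPochhammer ℂ q).eval (t + 1) := by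
    rw [cWeight, hri, hrj, add_right_comm, Int.cast_natCast, Int.cast_natCast, Gamma_add_nat _ hx,
      Gamma_add_nat _ ht1]
    have h1 := hx.Gamma_ne_zero
    have h2 := ht1.Gamma_ne_zero
    have h3 := ht1.ascPochhammer_ne_zero q
    field_simp
  have hterm : ∀ s ∈ Finset.range (q + 1), (eTot j i ^ s * eTot i j ^ s : Module.End ℂ (P k n)) f
      = (q.descFactorial s * (p + s).descFactorial s : ℂ) • f := by
    intro s hs
    have hsq : s ≤ q := Nat.lt_succ_iff.mp (Finset.mem_range.mp hs)
    rw [Module.End.mul_apply, hfdef, eTot_pow_X_pow hij, map_smul, mul_comm (X (i, a) ^ (p + s)),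
      eTot_pow_X_pow hij.symm, smul_smul, Nat.sub_add_cancel hsq, Nat.add_sub_cancel, mul_comm (X _ ^ _)]
  rw [hf.normalizedDynB_apply hij, hf.dynB_apply hij t (N := q + 1) (by omega), hri, hrj,
    Finset.sum_congr rfl fun s hs => by rw [hterm s hs, smul_smul], ← Finset.sum_smul, smul_smul]
  convert one_smul ℂ f
  -- The splitting `t + 1 = (p + 1) + (t - p)` is dictated by the terms: `(p + s)! / p!` is the
  -- rising factorial `(p+1)_s`, and the coefficients supply `(t-p)_{q-s}`.
  rw [hc, div_mul_eq_mul_div, div_eq_one_iff_eq (ht1.ascPochhammer_ne_zero q), Finset.mul_sum,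
    show t + 1 = ((p + 1 : ℕ) : ℂ) + (t - p) by push_cast; ring, ← sum_choose_ascPochhammer]
  refine Finset.sum_congr rfl fun s hs => ?_
  have hsq : s ≤ q := Nat.lt_succ_iff.mp (Finset.mem_range.mp hs)
  rw [← dynCoeff_mul_ascPochhammer hx q hsq, Nat.descFactorial_eq_factorial_mul_choose q s,
    Nat.add_descFactorial_eq_ascFactorial, ← ascPochhammer_nat_eq_ascFactorial,
    ← ascPochhammer_eval_cast]
  push_cast
  ring

end Normalization

/-! ## The R-matrix -/

section Yangian

variable {k : ℕ}

/-- The operators on `V ⊗ V` through which the Yangian acts on the left of the R-matrix. -/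
def yangianSource (t : ℂ) (a b : Fin k) : Module.End ℂ (P k 2) :=
  t • eSlot a b 0 + ∑ c : Fin k, eSlot a c 0 * eSlot c b 1

/-- The operators on `V ⊗ V` through which the Yangian acts on the right of the R-matrix. -/
def yangianTarget (t : ℂ) (a b : Fin k) : Module.End ℂ (P k 2) :=
  t • eSlot a b 0 + ∑ c : Fin k, eSlot c b 0 * eSlot a c 1

/-- The diagonal action of `gl_k` on `V ⊗ V`. -/
def diagAction (a b : Fin k) : Module.End ℂ (P k 2) := eSlot a b 0 + eSlot a b 1

lemma eSlot_apply_X_mul (a c b : Fin k) (g : P k 2) :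
    eSlot a c 0 (eSlot c b 1 (X (b, 0) * g))
      = X (a, 0) * (X (c, 1) * ((if b = c then 1 else 0) * pderiv (b, 1) g
        + X (b, 0) * pderiv (c, 0) (pderiv (b, 1) g))) := by
  have h1 : pderiv (b, 1) (X (b, 0) : P k 2) = 0 := pderiv_X_of_ne (by simp)
  have h2 : pderiv (c, 0) (X (c, 1) : P k 2) = 0 := pderiv_X_of_ne (by simp)
  have h3 : pderiv (c, 0) (X (b, 0) : P k 2) = if b = c then 1 else 0 := by
    rw [pderiv_X, Pi.single_apply]; simp [eq_comm]
  simp only [eSlot_eq, Module.End.mul_apply, mulX_apply, dX_apply, Derivation.leibniz, h1, h2, h3,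
    smul_eq_mul, mul_zero, add_zero]
  ring

/-! ### Generation of `V ⊗ V` by the vectors `x_1^p ⊗ x_1^q` -/

section Cyclicity

variable [NeZero k]

/-- The number of variables outside of the first row, and the number of those in the first column. -/
def lowerWt (k : ℕ) [NeZero k] (p : Fin k × Fin 2) : ℤ × ℤ :=
  if p.1 = 0 then 0 else if p.2 = 0 then (1, 1) else (1, 0)

lemma eq_zero_of_lowerWt_neg {f : P k 2} {m v : ℤ}
    (hf : IsWeightedHomogeneous (lowerWt k) f (m, v)) (hv : v < 0) : f = 0 := by
  by_contra hne
  obtain ⟨d, hd⟩ := MvPolynomial.ne_zero_iff.mp hne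
  have h := congrArg Prod.snd (hf hd)
  rw [Finsupp.weight_apply, Finsupp.sum, Prod.snd_sum] at h
  have : (0 : ℤ) ≤ ∑ p ∈ d.support, (d p • lowerWt k p).2 := by
    refine Finset.sum_nonneg fun p _ => ?_
    unfold lowerWt
    split_ifs <;> simp
  simp only at h
  omega

/-- The terms `c ≠ 0` have one variable outside the first row moved from the first column to the
second. The leading coefficient vanishes only for integral `t`. Together these allow an induction
that isolates `X (a, 0) * monomial d 1`. -/
lemma yangianSource_monomial (t : ℂ) (a : Fin k) (d : Fin k × Fin 2 →₀ ℕ) :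
    yangianSource t a 0 (X (0, 0) * monomial d 1)
      = ((d (0, 0) + 1) * (t + d (0, 1)) : ℂ) • (X (a, 0) * monomial d 1)
        + ∑ c : Fin k with c ≠ 0,
          X (a, 0) * (X (c, 1) * (X (0, 0) * pderiv (c, 0) (pderiv (0, 1) (monomial d 1)))) := by
  set g : P k 2 := monomial d 1 with hg
  have e1 : X (0, 0) * pderiv (0, 0) g = (d (0, 0) : ℂ) • g := by
    rw [hg, X_mul_pderiv_monomial, Nat.cast_smul_eq_nsmul]
  have e2 : X (0, 1) * pderiv (0, 1) g = (d (0, 1) : ℂ) • g := by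
    rw [hg, X_mul_pderiv_monomial, Nat.cast_smul_eq_nsmul]
  have h2 : pderiv (0, 0) (X (0, 1) : P k 2) = 0 := pderiv_X_of_ne (by simp)
  have e3 : X (0, 1) * (X (0, 0) * pderiv (0, 0) (pderiv (0, 1) g))
      = (d (0, 0) * d (0, 1) : ℂ) • g := by
    have := congrArg (fun f => X (0, 0) * pderiv (0, 0) f) e2
    simp only [Derivation.leibniz, h2, smul_eq_mul, mul_zero, add_zero] at this
    rw [mul_left_comm, this, Derivation.map_smul, mul_smul_comm, e1, smul_smul, mul_comm]
  have h1 : eSlot a 0 0 (X (0, 0) * g) = ((d (0, 0) + 1 : ℂ)) • (X (a, 0) * g) := by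
    simp only [eSlot_eq, Module.End.mul_apply, mulX_apply, dX_apply, Derivation.leibniz, e1,
      smul_eq_mul, pderiv_X_self]
    rw [mul_one, add_smul, one_smul, mul_add, mul_smul_comm]
  rw [yangianSource, LinearMap.add_apply, LinearMap.smul_apply, h1, LinearMap.sum_apply,
    ← Finset.add_sum_erase _ _ (Finset.mem_univ (0 : Fin k)), Module.End.mul_apply,
    eSlot_apply_X_mul, if_pos rfl, one_mul, mul_add, e2, e3, ← add_assoc]
  refine congrArg₂ (· + ·) ?_ ?_
  · rw [← add_smul, smul_smul, mul_smul_comm, ← add_smul]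
    congr 1
    ring
  · have : (Finset.univ.erase (0 : Fin k)) = Finset.univ.filter (fun c => c ≠ 0) := by
      ext c; simp
    rw [this]
    refine Finset.sum_congr rfl fun c hc => ?_
    rw [Module.End.mul_apply, eSlot_apply_X_mul, if_neg (Finset.mem_filter.mp hc).2.symm, zero_mul,
      zero_add]

lemma diagAction_monomial (a : Fin k) (d : Fin k × Fin 2 →₀ ℕ) :
    diagAction a 0 (X (0, 1) * monomial d 1)
      = X (a, 0) * (X (0, 1) * pderiv (0, 0) (monomial d 1))
        + (d (0, 1) + 1 : ℂ) • (X (a, 1) * monomial d 1) := by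
  have e2 : X (0, 1) * pderiv (0, 1) (monomial d 1 : P k 2) = (d (0, 1) : ℂ) • monomial d 1 := by
    rw [X_mul_pderiv_monomial, Nat.cast_smul_eq_nsmul]
  have h2 : pderiv (0, 0) (X (0, 1) : P k 2) = 0 := pderiv_X_of_ne (by simp)
  simp only [diagAction, LinearMap.add_apply, eSlot_eq, Module.End.mul_apply, mulX_apply, dX_apply,
    Derivation.leibniz, e2, h2, smul_eq_mul, pderiv_X_self, mul_zero, add_zero]
  rw [mul_one, add_smul, one_smul, mul_add, mul_smul_comm]

variable {S : Submodule ℂ (P k 2)} {t : ℂ}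

/-- Induction on the number `v` of first-column variables outside the first row: `yangianSource t a
0` applied to `X (0, 0) * g` is a nonzero multiple of `X (a, 0) * g` plus terms `X (a, 0) * g'` in
which `g'` has smaller `v`. -/
lemma X_mul_mem_of_cyclic (ht : NotInt t)
    (hA : ∀ a b, ∀ f ∈ S, yangianSource t a b f ∈ S) {m : ℤ}
    (hm : ∀ v f, IsWeightedHomogeneous (lowerWt k) f (m, v) → f ∈ S) (v : ℤ) (f : P k 2)
    (hf : IsWeightedHomogeneous (lowerWt k) f (m, v)) (a : Fin k) : X (a, 0) * f ∈ S := by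
  -- The degree is shifted by one so that the base case is degree `-1`, where only `f = 0` occurs.
  have key : ∀ (v : ℕ) (f : P k 2), IsWeightedHomogeneous (lowerWt k) f (m, (v : ℤ) - 1) →
      X (a, 0) * f ∈ S := by
    intro v
    induction v with
    | zero =>
      intro f hf
      rw [eq_zero_of_lowerWt_neg hf (by simp), mul_zero]
      exact S.zero_mem
    | succ v ih =>
      intro f hf
      refine mem_of_isWeightedHomogeneous hf (S := S.comap (LinearMap.mulLeft ℂ (X (a, 0))))
        fun d hd => ?_
      have hg : IsWeightedHomogeneous (lowerWt k) (monomial d (1 : ℂ)) (m, ((v + 1 : ℕ) : ℤ) - 1) :=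
        isWeightedHomogeneous_monomial _ _ _ hd
      rw [Submodule.mem_comap, LinearMap.mulLeft_apply]
      have h1 : yangianSource t a 0 (X (0, 0) * monomial d 1) ∈ S := by
        refine hA a 0 _ (hm (((v + 1 : ℕ) : ℤ) - 1) _ ?_)
        have := (isWeightedHomogeneous_X ℂ (lowerWt k) (0, 0)).mul hg
        rwa [show lowerWt k (0, 0) = 0 by simp [lowerWt], zero_add] at this
      rw [yangianSource_monomial] at h1
      have h2 : ∑ c : Fin k with c ≠ 0, X (a, 0) *
          (X (c, 1) * (X (0, 0) * pderiv (c, 0) (pderiv (0, 1) (monomial d 1)))) ∈ S := by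
        refine S.sum_mem fun c hc => ih _ ?_
        have hc' : c ≠ 0 := (Finset.mem_filter.mp hc).2
        have g1 : IsWeightedHomogeneous (lowerWt k) (pderiv (0, 1) (monomial d (1 : ℂ)))
            (m, ((v + 1 : ℕ) : ℤ) - 1) :=
          IsWeightedHomogeneous.pderiv hg (by simp [lowerWt])
        have g2 : IsWeightedHomogeneous (lowerWt k) (pderiv (c, 0) (pderiv (0, 1) (monomial d (1 : ℂ))))
            (m - 1, (v : ℤ) - 1) :=
          IsWeightedHomogeneous.pderiv g1 (by simp [lowerWt, hc'])
        have g3 := (isWeightedHomogeneous_X ℂ (lowerWt k) (c, 1)).mul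
          ((isWeightedHomogeneous_X ℂ (lowerWt k) (0, 0)).mul g2)
        rwa [show lowerWt k (c, 1) + (lowerWt k (0, 0) + (m - 1, (v : ℤ) - 1)) = (m, (v : ℤ) - 1) by
          simp [lowerWt, hc']] at g3
      have h3 := S.sub_mem h1 h2
      rw [add_sub_cancel_right] at h3
      refine (S.smul_mem_iff (mul_ne_zero ?_ ?_)).mp h3
      · exact_mod_cast Nat.succ_ne_zero (d (0, 0))
      · exact_mod_cast (ht.add_int (d (0, 1))) 0
  rcases lt_or_ge v 0 with hv | hv
  · rw [eq_zero_of_lowerWt_neg hf hv, mul_zero]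
    exact S.zero_mem
  · refine key (v.toNat + 1) f ?_
    rwa [show ((v.toNat + 1 : ℕ) : ℤ) - 1 = v by push_cast; omega]

/-- The vectors `x_1^p ⊗ x_1^q` generate `V ⊗ V`. -/
theorem eq_top_of_cyclic (ht : NotInt t)
    (hA : ∀ a b, ∀ f ∈ S, yangianSource t a b f ∈ S)
    (hG : ∀ a b, ∀ f ∈ S, diagAction a b f ∈ S)
    (h0 : ∀ p q : ℕ, X (0, 0) ^ p * X (0, 1) ^ q ∈ S) : S = ⊤ := by
  -- Induction on the number of variables outside the first row. At `m = 0` the monomials are the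
  -- given vectors; otherwise one such variable is split off.
  have key : ∀ (m : ℕ) (v : ℤ) (f : P k 2), IsWeightedHomogeneous (lowerWt k) f ((m : ℤ), v) →
      f ∈ S := by
    intro m
    induction m with
    | zero =>
      intro v f hf
      refine mem_of_isWeightedHomogeneous hf fun d hd => ?_
      have hd0 : ∀ a c, a ≠ 0 → d (a, c) = 0 := by
        intro a c ha
        have h := congrArg Prod.fst hd
        rw [Finsupp.weight_apply, Finsupp.sum_fintype _ _ (by simp), Prod.fst_sum] at h
        have h' := (Finset.sum_eq_zero_iff_of_nonneg (fun p _ => by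
          unfold lowerWt
          split_ifs <;> simp)).mp h (a, c) (Finset.mem_univ _)
        unfold lowerWt at h'
        split_ifs at h' <;> simp_all
      have : (monomial d (1 : ℂ) : P k 2) = X (0, 0) ^ d (0, 0) * X (0, 1) ^ d (0, 1) := by
        rw [monomial_eq, Finsupp.prod_fintype _ _ (by simp), Fintype.prod_prod_type,
          Finset.prod_eq_single 0]
        · simp
        · intro a _ ha
          simp [hd0 a _ ha]
        · simp
      rw [this]
      exact h0 _ _
    | succ m ih =>
      intro v f hf
      refine mem_of_isWeightedHomogeneous hf fun d hd => ?_
      have hex : ∃ a c, a ≠ 0 ∧ d (a, c) ≠ 0 := by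
        by_contra! hcon
        have h := congrArg Prod.fst hd
        rw [Finsupp.weight_apply, Finsupp.sum_fintype _ _ (by simp), Prod.fst_sum,
          Finset.sum_eq_zero] at h
        · simp only at h; omega
        · rintro ⟨a, c⟩ _
          by_cases ha : a = 0
          · simp [lowerWt, ha]
          · simp [hcon a c ha]
      obtain ⟨a, c, ha, hac⟩ := hex
      obtain ⟨e, rfl⟩ : ∃ e, d = Finsupp.single (a, c) 1 + e :=
        ⟨d - Finsupp.single (a, c) 1, by
          rw [add_tsub_cancel_of_le]
          exact Finsupp.single_le_iff.mpr (Nat.one_le_iff_ne_zero.mpr hac)⟩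
      rw [map_add, Finsupp.weight_single, one_smul] at hd
      have hprod : (monomial (Finsupp.single (a, c) 1 + e) (1 : ℂ) : P k 2)
          = X (a, c) * monomial e 1 := by
        rw [X, monomial_mul, one_mul]
      rw [hprod]
      have he : ∃ v', IsWeightedHomogeneous (lowerWt k) (monomial e (1 : ℂ)) ((m : ℤ), v') := by
        refine ⟨(Finsupp.weight (lowerWt k) e).2, isWeightedHomogeneous_monomial _ _ _ ?_⟩
        have h := congrArg Prod.fst hd
        refine Prod.ext ?_ rfl
        have h1 : (lowerWt k (a, c)).1 = 1 := by
          simp only [lowerWt, ha, if_false]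
          split_ifs <;> rfl
        rw [Prod.fst_add, h1] at h
        push_cast at h
        simp only
        omega
      obtain ⟨v', he⟩ := he
      have hY := X_mul_mem_of_cyclic ht hA ih
      by_cases hc : c = 0
      · rw [hc]
        exact hY v' _ he a
      -- A second-column variable is created from `X (0, 1)` by `diagAction a 0`. The other term
      -- produced begins with `X (a, 0)`, a case already settled by `hY`.
      · have hc1 : c = 1 := by omega
        rw [hc1]
        have h1 : diagAction a 0 (X (0, 1) * monomial e 1) ∈ S := by
          refine hG a 0 _ (ih v' _ ?_)
          have := (isWeightedHomogeneous_X ℂ (lowerWt k) (0, 1)).mul he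
          rwa [show lowerWt k (0, 1) = 0 by simp [lowerWt], zero_add] at this
        have h2 : X (a, 0) * (X (0, 1) * pderiv (0, 0) (monomial e 1)) ∈ S := by
          refine hY v' _ ?_ a
          have g1 : IsWeightedHomogeneous (lowerWt k) (pderiv (0, 0) (monomial e (1 : ℂ)))
              ((m : ℤ), v') := IsWeightedHomogeneous.pderiv he (by simp [lowerWt])
          have := (isWeightedHomogeneous_X ℂ (lowerWt k) (0, 1)).mul g1
          rwa [show lowerWt k (0, 1) = 0 by simp [lowerWt], zero_add] at this
        rw [diagAction_monomial] at h1
        have h3 := S.sub_mem h1 h2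
        rw [add_sub_cancel_left] at h3
        refine (S.smul_mem_iff ?_).mp h3
        exact_mod_cast Nat.succ_ne_zero (e (0, 1))
  rw [eq_top_iff]
  intro f _
  rw [f.as_sum]
  refine S.sum_mem fun d _ => ?_
  have hnn : (0 : ℤ) ≤ (Finsupp.weight (lowerWt k) d).1 := by
    rw [Finsupp.weight_apply, Finsupp.sum_fintype _ _ (by simp), Prod.fst_sum]
    refine Finset.sum_nonneg fun p _ => ?_
    unfold lowerWt
    split_ifs <;> simp
  refine key (Finsupp.weight (lowerWt k) d).1.toNat (Finsupp.weight (lowerWt k) d).2 _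
    (isWeightedHomogeneous_monomial _ _ _ (Prod.ext ?_ rfl))
  simp [hnn]

end Cyclicity

/-! ### Existence, uniqueness and unitarity of the R-matrix -/

section RMatrix

variable [NeZero k] {t : ℂ}

lemma IsRMatrix.mul_yangianSource {R : Module.End ℂ (P k 2)} (h : IsRMatrix k t R) (a b : Fin k) :
    R * yangianSource t a b = yangianTarget t a b * R := h.intertwine a b

lemma IsRMatrix.mul_diagAction {R : Module.End ℂ (P k 2)} (h : IsRMatrix k t R) (a b : Fin k) :
    R * diagAction a b = diagAction a b * R := h.invariant a b

/-- An endomorphism of `V ⊗ V` is determined by its values on the `x_1^p ⊗ x_1^q` if it intertwines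
two given families of operators. -/
lemma eq_of_intertwines (ht : NotInt t) {R R' : Module.End ℂ (P k 2)}
    {T : Fin k → Fin k → Module.End ℂ (P k 2)}
    (hA : ∀ a b, R * yangianSource t a b = T a b * R)
    (hA' : ∀ a b, R' * yangianSource t a b = T a b * R')
    (hG : ∀ a b, R * diagAction a b = diagAction a b * R)
    (hG' : ∀ a b, R' * diagAction a b = diagAction a b * R')
    (h0 : ∀ p q : ℕ, R (X (0, 0) ^ p * X (0, 1) ^ q) = R' (X (0, 0) ^ p * X (0, 1) ^ q)) :
    R = R' := by
  have htop : LinearMap.eqLocus R R' = ⊤ := by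
    refine eq_top_of_cyclic ht (fun a b f hf => ?_) (fun a b f hf => ?_) h0
    · rw [LinearMap.mem_eqLocus] at hf ⊢
      rw [← Module.End.mul_apply, ← Module.End.mul_apply, hA, hA', Module.End.mul_apply, hf]; rfl
    · rw [LinearMap.mem_eqLocus] at hf ⊢
      rw [← Module.End.mul_apply, ← Module.End.mul_apply, hG, hG', Module.End.mul_apply, hf]; rfl
  exact LinearMap.eqLocus_eq_top.mp htop

lemma IsRMatrix.unique (ht : NotInt t) {R R' : Module.End ℂ (P k 2)} (h : IsRMatrix k t R)
    (h' : IsRMatrix k t R') : R = R' :=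
  eq_of_intertwines ht h.mul_yangianSource h'.mul_yangianSource h.mul_diagAction h'.mul_diagAction
    fun p q => by rw [h.normalized, h'.normalized]

omit [NeZero k] in
-- The sum over the inner index `c` of `gl_k` is, after transposition, a single generator of the
-- dual `gl_2`.
lemma transEnd_yangianSource (t : ℂ) (a b : Fin k) :
    transEnd k 2 (yangianSource t a b) = intertwinerSource 0 1 t a b := by
  rw [yangianSource, intertwinerSource, map_add, map_smul, transEnd_eSlot, map_sum, eTot_eq,
    Finset.mul_sum, Finset.sum_mul]
  refine congrArg₂ (· + ·) rfl (Finset.sum_congr rfl fun c _ => ?_)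
  have h := dX_mulX_of_ne (σ := Fin 2 × Fin k) (p := (0, c)) (q := (1, c)) (by simp)
  rw [map_mul, transEnd_eSlot, transEnd_eSlot, mul_assoc, ← mul_assoc (dX _), h]
  simp only [mul_assoc]

omit [NeZero k] in
lemma transEnd_yangianTarget (t : ℂ) (a b : Fin k) :
    transEnd k 2 (yangianTarget t a b) = intertwinerTarget 0 1 t a b := by
  rw [yangianTarget, intertwinerTarget, map_add, map_smul, transEnd_eSlot, map_sum, eTot_eq,
    Finset.mul_sum, Finset.sum_mul]
  refine congrArg₂ (· + ·) rfl (Finset.sum_congr rfl fun c _ => ?_)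
  rw [map_mul, transEnd_eSlot, transEnd_eSlot]
  exact mulX_mul_dX_exchange (by simp)

omit [NeZero k] in
lemma transEnd_diagAction (a b : Fin k) :
    transEnd k 2 (diagAction a b) = ∑ c : Fin 2, mulX (c, a) * dX (c, b) := by
  rw [diagAction, map_add, transEnd_eSlot, transEnd_eSlot, Fin.sum_univ_two]

omit [NeZero k] in
lemma transpose_mem_bihom {p q : ℕ} {r : Fin 2 → ℤ} (h0 : r 0 = p) (h1 : r 1 = q) {f : P 2 k}
    (hf : IsWt r f) : transpose 2 k f ∈ bihom k p q := by
  refine mem_of_isWeightedHomogeneous hf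
    (S := (bihom k p q).comap (transpose 2 k).toLinearMap) fun d hd => ?_
  refine Submodule.subset_span ⟨expSwap 2 k d, ?_, ?_, transpose_monomial' d 1⟩
  · have h := weight_rowWt d 0
    rw [hd, h0] at h
    simp only [expSwap_apply]
    exact_mod_cast h.symm
  · have h := weight_rowWt d 1
    rw [hd, h1] at h
    simp only [expSwap_apply]
    exact_mod_cast h.symm

/-- The R-matrix is `C_{12}(t) B_{12}(t)` for the dual Lie algebra. -/
theorem isRMatrix_transEnd (ht : NotInt t) :
    IsRMatrix k t (transEnd 2 k (normalizedDynB 0 1 t)) := by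
  have h01 : (0 : Fin 2) ≠ 1 := by decide
  have hT : ∀ A B : Module.End ℂ (P k 2),
      normalizedDynB 0 1 t * transEnd k 2 A = transEnd k 2 B * normalizedDynB 0 1 t →
      transEnd 2 k (normalizedDynB 0 1 t) * A = B * transEnd 2 k (normalizedDynB 0 1 t) := by
    intro A B h
    have := congrArg (transEnd 2 k) h
    simpa only [map_mul, transEnd_transEnd] using this
  refine ⟨fun p q f hf => ?_, fun a b => hT _ _ ?_, fun a b => hT _ _ ?_, fun p q => ?_⟩
  -- The bidegree in the two tensor factors is the weight for the dual `gl_2`, which the normalized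
  -- series preserves.
  · induction hf using Submodule.span_induction with
    | mem f hf =>
      obtain ⟨d, hp, hq, rfl⟩ := hf
      have hw := isWt_monomial (expSwap k 2 d) 1
      have h : transEnd 2 k (normalizedDynB 0 1 t) (monomial d 1)
          = transpose 2 k (normalizedDynB 0 1 t (monomial (expSwap k 2 d) 1)) := by
        rw [transpose_apply_end, ← transpose_monomial', transpose_transpose]
      rw [h]
      refine transpose_mem_bihom ?_ ?_ (hw.normalizedDynB_mem h01 t)
      · rw [weight_rowWt]; simp only [expSwap_apply]; exact_mod_cast hp
      · rw [weight_rowWt]; simp only [expSwap_apply]; exact_mod_cast hq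
    | zero => rw [map_zero]; exact Submodule.zero_mem _
    | add f g _ _ hf hg => rw [map_add]; exact Submodule.add_mem _ hf hg
    | smul c f _ hf => rw [map_smul]; exact Submodule.smul_mem _ c hf
  · have h := transEnd_diagAction a b
    rw [diagAction] at h
    rw [h]
    exact normalizedDynB_comm h01 t (fun r f hf => hf.colSum_mem a b) (dynB_mul_colSum h01 t a b)
  · have h := transEnd_yangianSource t a b
    have h' := transEnd_yangianTarget t a b
    rw [yangianSource] at h
    rw [yangianTarget] at h'
    rw [h, h']
    exact normalizedDynB_comm h01 t (fun r f hf => hf.intertwinerSource_mem 0 1 t a b)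
      (dynB_mul_intertwinerSource h01 ht a b)
  · have h : (X (0, 0) ^ p * X (0, 1) ^ q : P k 2)
        = transpose 2 k (X (0, 0) ^ p * X (1, 0) ^ q) := by
      simp [transpose_X]
    rw [h, ← transpose_apply_end, normalizedDynB_X_pow h01 ht]

lemma existsUnique_isRMatrix (ht : NotInt t) : ∃! R, IsRMatrix k t R :=
  ⟨_, isRMatrix_transEnd ht, fun _ h => h.unique ht (isRMatrix_transEnd ht)⟩

lemma rMatrix_eq (ht : NotInt t) : rMatrix k t = transEnd 2 k (normalizedDynB 0 1 t) := by
  have h : ∃ R, IsRMatrix k t R := ⟨_, isRMatrix_transEnd ht⟩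
  rw [rMatrix, dif_pos h]
  exact h.choose_spec.unique ht (isRMatrix_transEnd ht)

/-- The exchange of the tensor factors of `V ⊗ V`. -/
def colSwap (k : ℕ) : P k 2 ≃ₐ[ℂ] P k 2 :=
  renameEquiv ℂ ((Equiv.refl (Fin k)).prodCongr (Equiv.swap 0 1))

/-- Conjugation by the exchange of the tensor factors of `V ⊗ V`. -/
def swapEnd (k : ℕ) : Module.End ℂ (P k 2) ≃ₐ[ℂ] Module.End ℂ (P k 2) :=
  (colSwap k).toLinearEquiv.conjAlgEquiv ℂ

omit [NeZero k] in
@[simp] lemma colSwap_colSwap (f : P k 2) : colSwap k (colSwap k f) = f := by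
  simp only [colSwap, renameEquiv_apply, rename_rename]
  convert rename_id_apply f
  ext x <;> simp

omit [NeZero k] in
lemma colSwap_apply_end (A : Module.End ℂ (P k 2)) (f : P k 2) :
    colSwap k (A f) = swapEnd k A (colSwap k f) := by
  simp [swapEnd, LinearEquiv.conjAlgEquiv]

omit [NeZero k] in
@[simp] lemma swapEnd_swapEnd (A : Module.End ℂ (P k 2)) : swapEnd k (swapEnd k A) = A := by
  refine LinearMap.ext fun f => ?_
  have h := colSwap_apply_end (swapEnd k A) (colSwap k f)
  rw [colSwap_colSwap] at h
  rw [← h, ← colSwap_apply_end, colSwap_colSwap]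

omit [NeZero k] in
lemma swapEnd_eSlot (a b : Fin k) (i : Fin 2) :
    swapEnd k (eSlot a b i) = eSlot a b (Equiv.swap 0 1 i) := by
  refine LinearMap.ext fun f => ?_
  obtain ⟨f, rfl⟩ := (colSwap k).surjective f
  rw [← colSwap_apply_end]
  simp only [eSlot_eq, Module.End.mul_apply, mulX_apply, dX_apply, map_mul]
  simp only [colSwap, renameEquiv_apply, rename_X]
  refine congrArg₂ (· * ·) rfl ?_
  exact (pderiv_rename ((Equiv.refl (Fin k)).prodCongr (Equiv.swap 0 1)).injective (b, i) f).symm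

omit [NeZero k] in
lemma eSlot_comm_of_ne (a b c d : Fin k) :
    (eSlot a b 0 * eSlot c d 1 : Module.End ℂ (P k 2)) = eSlot c d 1 * eSlot a b 0 :=
  mulX_mul_dX_comm (by simp) (by simp)

omit [NeZero k] in
lemma swapEnd_diagAction (a b : Fin k) : swapEnd k (diagAction a b) = diagAction a b := by
  rw [diagAction, map_add, swapEnd_eSlot, swapEnd_eSlot, Equiv.swap_apply_left,
    Equiv.swap_apply_right, add_comm]

omit [NeZero k] in
-- The exchange of factors together with `t ↦ -t` interchanges source and target up to a multiple of
-- the diagonal action, which R-matrices respect anyway.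
lemma swapEnd_yangianSource (t : ℂ) (a b : Fin k) :
    swapEnd k (yangianSource (-t) a b) = yangianTarget t a b - t • diagAction a b := by
  rw [yangianSource, map_add, map_smul, map_sum, swapEnd_eSlot, yangianTarget, diagAction]
  simp only [map_mul, swapEnd_eSlot, Equiv.swap_apply_left, Equiv.swap_apply_right,
    eSlot_comm_of_ne]
  module

omit [NeZero k] in
lemma swapEnd_yangianTarget (t : ℂ) (a b : Fin k) :
    swapEnd k (yangianTarget (-t) a b) = yangianSource t a b - t • diagAction a b := by
  have h := congrArg (swapEnd k) (swapEnd_yangianSource (-t) a b)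
  rw [swapEnd_swapEnd, neg_neg, map_sub, map_smul, swapEnd_diagAction] at h
  rw [h]
  module

/-- The unitarity of the R-matrix. -/
lemma IsRMatrix.swapEnd_mul (ht : NotInt t) {R R' : Module.End ℂ (P k 2)} (h : IsRMatrix k t R)
    (h' : IsRMatrix k (-t) R') : swapEnd k R' * R = 1 := by
  have hG : ∀ a b, swapEnd k R' * diagAction a b = diagAction a b * swapEnd k R' := by
    intro a b
    have := congrArg (swapEnd k) (h'.mul_diagAction a b)
    simpa only [map_mul, swapEnd_diagAction] using this
  have hA : ∀ a b, swapEnd k R' * yangianTarget t a b = yangianSource t a b * swapEnd k R' := by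
    intro a b
    have := congrArg (swapEnd k) (h'.mul_yangianSource a b)
    rw [map_mul, map_mul, swapEnd_yangianSource, swapEnd_yangianTarget, mul_sub, sub_mul,
      mul_smul_comm, smul_mul_assoc, hG] at this
    exact sub_left_injective this
  -- The product and the identity both commute with the source operators and the diagonal action and
  -- fix the vectors `x_1^p ⊗ x_1^q`, so they agree by cyclicity.
  refine eq_of_intertwines ht (T := yangianSource t) (fun a b => ?_) (fun a b => ?_)
    (fun a b => ?_) (fun a b => ?_) fun p q => ?_
  · rw [mul_assoc, h.mul_yangianSource, ← mul_assoc, hA, mul_assoc]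
  · rw [one_mul, mul_one]
  · rw [mul_assoc, h.mul_diagAction, ← mul_assoc, hG, mul_assoc]
  · rw [one_mul, mul_one]
  · have hs : (X (0, 0) ^ p * X (0, 1) ^ q : P k 2)
        = colSwap k (X (0, 0) ^ q * X (0, 1) ^ p) := by
      simp [colSwap, mul_comm]
    rw [Module.End.mul_apply, h.normalized, hs, ← colSwap_apply_end, h'.normalized,
      Module.End.one_apply]

lemma isUnit_rMatrix (ht : NotInt t) : IsUnit (rMatrix k t) := by
  have h := isRMatrix_transEnd (k := k) ht
  have h' := isRMatrix_transEnd (k := k) ht.neg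
  rw [← rMatrix_eq ht] at h
  rw [← rMatrix_eq ht.neg] at h'
  refine ⟨⟨_, swapEnd k (rMatrix k (-t)), ?_, h.swapEnd_mul ht h'⟩, rfl⟩
  -- The inverse on the other side is unitarity at `-t`, conjugated by the exchange of factors.
  have := congrArg (swapEnd k) (h'.swapEnd_mul ht.neg (R' := rMatrix k t) (by rwa [neg_neg]))
  rwa [map_mul, swapEnd_swapEnd, map_one] at this

end RMatrix

end Yangian

/-! ## R-matrices in two tensor factors -/

section TensorFactors

variable {k n : ℕ}

/-! ### Operators acting in two columns, and their duals acting in two rows -/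

section PairOp

variable {i j : Fin n}

lemma pair_injective (hij : i ≠ j) : Function.Injective ![i, j] := by
  intro a b h
  fin_cases a <;> fin_cases b <;> simp_all

lemma mem_range_pair (hij : i ≠ j) {c : Fin n} (h : c = i ∨ c = j) : ∃ e : Fin 2, ![i, j] e = c := by
  rcases h with rfl | rfl
  · exact ⟨0, rfl⟩
  · exact ⟨1, rfl⟩

/-- The inclusion of the columns `i`, `j` of variables. -/
def colPair (k : ℕ) (i j : Fin n) (p : Fin k × Fin 2) : Fin k × Fin n := (p.1, ![i, j] p.2)

lemma colPair_injective (hij : i ≠ j) : Function.Injective (colPair k i j) := by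
  rintro ⟨a, b⟩ ⟨c, d⟩ h
  obtain ⟨h1, h2⟩ := Prod.mk.inj h
  exact Prod.ext h1 (pair_injective hij h2)

lemma pairOp_monomial (A : Module.End ℂ (P k 2)) (d : Fin k × Fin n →₀ ℕ) :
    pairOp i j A (monomial d 1) = rename (colPair k i j)
        (A (monomial (Finsupp.equivFunOnFinite.symm (fun p => d (colPair k i j p))) 1))
      * monomial (d.filter (fun p => p.2 ≠ i ∧ p.2 ≠ j)) 1 := by
  have h := (basisMonomials (Fin k × Fin n) ℂ).constr_basis ℂ (fun d =>
    rename (fun p : Fin k × Fin 2 => (p.1, ![i, j] p.2))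
        (A (monomial (Finsupp.equivFunOnFinite.symm
          (fun p : Fin k × Fin 2 => d (p.1, ![i, j] p.2))) (1 : ℂ)))
      * monomial (d.filter (fun p => p.2 ≠ i ∧ p.2 ≠ j)) (1 : ℂ)) d
  rw [coe_basisMonomials] at h
  exact h

lemma monomial_eq_rename_mul (hij : i ≠ j) (d : Fin k × Fin n →₀ ℕ) :
    (monomial d (1 : ℂ)) = rename (colPair k i j)
        (monomial (Finsupp.equivFunOnFinite.symm (fun p => d (colPair k i j p))) 1)
      * monomial (d.filter (fun p => p.2 ≠ i ∧ p.2 ≠ j)) 1 := by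
  rw [rename_monomial, monomial_mul, one_mul]
  refine congrArg (fun x => monomial x (1 : ℂ)) ?_
  ext ⟨a, c⟩
  rw [Finsupp.add_apply]
  by_cases hc : c = i ∨ c = j
  · obtain ⟨e, rfl⟩ := mem_range_pair hij hc
    have h := Finsupp.mapDomain_apply (colPair_injective (k := k) hij)
      (Finsupp.equivFunOnFinite.symm (fun p => d (colPair k i j p))) (a, e)
    rw [show ((a, ![i, j] e) : Fin k × Fin n) = colPair k i j (a, e) from rfl, h,
      Finsupp.filter_apply_neg]
    · simp
    · simp only [colPair]; tauto
  · rw [Finsupp.mapDomain_of_notMem_range, Finsupp.filter_apply_pos, zero_add]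
    · simp only; tauto
    · rintro ⟨⟨a', e⟩, h⟩
      have h' := congrArg Prod.snd h
      simp only [colPair] at h'
      fin_cases e <;> simp at h' <;> tauto

lemma pairOp_apply (hij : i ≠ j) (A : Module.End ℂ (P k 2)) (f : P k 2)
    (e : Fin k × Fin n →₀ ℕ) (he : ∀ a c, c = i ∨ c = j → e (a, c) = 0) :
    pairOp i j A (rename (colPair k i j) f * monomial e 1)
      = rename (colPair k i j) (A f) * monomial e 1 := by
  have hlin : ∀ c : Fin k × Fin 2 →₀ ℕ,
      pairOp i j A (rename (colPair k i j) (monomial c 1) * monomial e 1)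
        = rename (colPair k i j) (A (monomial c 1)) * monomial e 1 := by
    intro c
    rw [rename_monomial, monomial_mul, one_mul, pairOp_monomial]
    have h1 : Finsupp.equivFunOnFinite.symm
        (fun p => (c.mapDomain (colPair k i j) + e) (colPair k i j p)) = c := by
      ext ⟨a, b⟩
      rw [Finsupp.equivFunOnFinite_symm_apply_apply, Finsupp.add_apply,
        Finsupp.mapDomain_apply (colPair_injective hij), colPair, he, add_zero]
      fin_cases b <;> simp
    have h2 : (c.mapDomain (colPair k i j) + e).filter (fun p => p.2 ≠ i ∧ p.2 ≠ j) = e := by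
      ext ⟨a, b⟩
      by_cases hb : b = i ∨ b = j
      · rw [Finsupp.filter_apply_neg, he a b hb]
        simp only; tauto
      · rw [Finsupp.filter_apply_pos, Finsupp.add_apply, Finsupp.mapDomain_of_notMem_range, zero_add]
        · rintro ⟨⟨a', e⟩, h⟩
          have h' := congrArg Prod.snd h
          simp only [colPair] at h'
          fin_cases e <;> simp at h' <;> tauto
        · simp only; tauto
    rw [h1, h2]
  rw [f.as_sum]
  simp only [map_sum, Finset.sum_mul]
  refine Finset.sum_congr rfl fun c _ => ?_
  rw [show monomial c (coeff c f) = coeff c f • monomial c (1 : ℂ) by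
    rw [smul_monomial, smul_eq_mul, mul_one]]
  simp only [map_smul, smul_mul_assoc, hlin]

/-- Each monomial is a product of a monomial in the columns `i`, `j` and one in the remaining
columns, so testing on such products suffices. -/
lemma eq_pairOp (hij : i ≠ j) {A : Module.End ℂ (P k 2)} {T : Module.End ℂ (P k n)}
    (h : ∀ (c : Fin k × Fin 2 →₀ ℕ) (e : Fin k × Fin n →₀ ℕ),
      (∀ a c, c = i ∨ c = j → e (a, c) = 0) →
      T (rename (colPair k i j) (monomial c 1) * monomial e 1)
        = rename (colPair k i j) (A (monomial c 1)) * monomial e 1) :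
    T = pairOp i j A := by
  refine end_ext fun d => ?_
  rw [pairOp_monomial, ← h, ← monomial_eq_rename_mul hij]
  intro a c hc
  rw [Finsupp.filter_apply_neg]
  simp only
  tauto

lemma pairOp_mul (hij : i ≠ j) (A B : Module.End ℂ (P k 2)) :
    pairOp i j (A * B) = pairOp i j A * pairOp i j B := by
  refine (eq_pairOp hij fun c e he => ?_).symm
  rw [Module.End.mul_apply, pairOp_apply hij _ _ _ he, pairOp_apply hij _ _ _ he,
    Module.End.mul_apply]

lemma pairOp_one (hij : i ≠ j) : pairOp i j (1 : Module.End ℂ (P k 2)) = 1 :=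
  (eq_pairOp hij fun c e _ => by simp).symm

lemma isUnit_pairOp (hij : i ≠ j) {A : Module.End ℂ (P k 2)} (hA : IsUnit A) :
    IsUnit (pairOp i j A) := by
  obtain ⟨u, rfl⟩ := hA
  refine ⟨⟨pairOp i j u, pairOp i j ↑u⁻¹, ?_, ?_⟩, rfl⟩
  · rw [← pairOp_mul hij, Units.mul_inv, pairOp_one hij]
  · rw [← pairOp_mul hij, Units.inv_mul, pairOp_one hij]

/-- The inclusion of the rows `i`, `j` of variables. -/
def rowPair (k : ℕ) (i j : Fin n) (p : Fin 2 × Fin k) : Fin n × Fin k := (![i, j] p.1, p.2)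

lemma rowPair_injective (hij : i ≠ j) : Function.Injective (rowPair k i j) := by
  rintro ⟨a, b⟩ ⟨c, d⟩ h
  obtain ⟨h1, h2⟩ := Prod.mk.inj h
  exact Prod.ext (pair_injective hij h1) h2

variable {e : Fin n × Fin k →₀ ℕ}

lemma eTot_rename_mul (hij : i ≠ j) (he : ∀ c a, c = i ∨ c = j → e (c, a) = 0) (b c : Fin 2)
    (f : P 2 k) :
    eTot (![i, j] b) (![i, j] c) (rename (rowPair k i j) f * monomial e 1)
      = rename (rowPair k i j) (eTot b c f) * monomial e 1 := by
  simp only [eTot_eq, LinearMap.sum_apply, map_sum, Finset.sum_mul]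
  refine Finset.sum_congr rfl fun a _ => ?_
  have h1 : pderiv (![i, j] c, a) (monomial e (1 : ℂ)) = 0 := by
    rw [pderiv_monomial, he _ a (by fin_cases c <;> simp)]
    simp
  have h2 : pderiv (![i, j] c, a) (rename (rowPair k i j) f)
      = rename (rowPair k i j) (pderiv (c, a) f) :=
    pderiv_rename (rowPair_injective hij) (c, a) f
  simp only [Module.End.mul_apply, mulX_apply, dX_apply, Derivation.leibniz, h1, h2, smul_eq_mul,
    mul_zero, zero_add, map_mul, rename_X]
  rw [show rowPair k i j (b, a) = (![i, j] b, a) from rfl]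
  ring

lemma eTot_pow_rename_mul (hij : i ≠ j) (he : ∀ c a, c = i ∨ c = j → e (c, a) = 0) (b c : Fin 2)
    (s : ℕ) (f : P 2 k) :
    (eTot (![i, j] b) (![i, j] c) ^ s) (rename (rowPair k i j) f * monomial e 1)
      = rename (rowPair k i j) ((eTot b c ^ s) f) * monomial e 1 := by
  induction s with
  | zero => simp
  | succ s ih => rw [end_pow_succ_apply, ih, eTot_rename_mul hij he, ← end_pow_succ_apply]

/-- The generators involved differentiate only in the rows `i`, `j`, so the extra monomial is a
constant for them, and it does not change the weights `r_i`, `r_j` in the coefficients. The operator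
of `gl_n` thus reduces to that of `gl_2`. -/
lemma normalizedDynB_rename_mul (hij : i ≠ j) (he : ∀ c a, c = i ∨ c = j → e (c, a) = 0) (t : ℂ)
    (d : Fin 2 × Fin k →₀ ℕ) :
    normalizedDynB i j t (rename (rowPair k i j) (monomial d 1) * monomial e 1)
      = rename (rowPair k i j) (normalizedDynB 0 1 t (monomial d 1)) * monomial e 1 := by
  have hf := isWt_monomial d 1
  set r := Finsupp.weight (rowWt 2 k) d
  have hmon : rename (rowPair k i j) (monomial d (1 : ℂ)) * monomial e 1
      = monomial (d.mapDomain (rowPair k i j) + e) 1 := by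
    rw [rename_monomial, monomial_mul, one_mul]
  have hg := isWt_monomial (d.mapDomain (rowPair k i j) + e) 1
  have hr : ∀ c : Fin 2,
      Finsupp.weight (rowWt n k) (d.mapDomain (rowPair k i j) + e) (![i, j] c) = r c := by
    intro c
    rw [weight_rowWt, show r c = _ from weight_rowWt d c]
    refine Finset.sum_congr rfl fun a _ => ?_
    rw [Finsupp.add_apply, he _ a (by fin_cases c <;> simp), add_zero]
    exact congrArg _ (Finsupp.mapDomain_apply (rowPair_injective hij) d (c, a))
  have hr0 := hr 0
  have hr1 := hr 1
  simp only [Matrix.cons_val_zero, Matrix.cons_val_one] at hr0 hr1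
  rw [← hmon] at hg
  rw [hg.normalizedDynB_apply hij, hf.normalizedDynB_apply (by decide),
    hg.dynB_apply hij t (N := (r 1).toNat + 1) (by omega),
    hf.dynB_apply (by decide) t (N := (r 1).toNat + 1) (by omega), cWeight, cWeight, hr0, hr1]
  simp only [map_smul, map_sum, smul_mul_assoc, Finset.sum_mul]
  refine congrArg _ (Finset.sum_congr rfl fun s _ => congrArg _ ?_)
  have hF := eTot_pow_rename_mul hij he 0 1 s (monomial d 1)
  have hE := eTot_pow_rename_mul hij he 1 0 s ((eTot 0 1 ^ s) (monomial d 1))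
  simp only [Matrix.cons_val_zero, Matrix.cons_val_one] at hF hE
  rw [Module.End.mul_apply, Module.End.mul_apply, hF, hE]

lemma transpose_rename_colPair (f : P k 2) :
    transpose k n (rename (colPair k i j) f) = rename (rowPair k i j) (transpose k 2 f) := by
  simp only [transpose, renameEquiv_apply, rename_rename]
  rfl

/-- The duality between R-matrices and the series `B_{ij}(t)`. -/
theorem transEnd_rOp [NeZero k] (hij : i ≠ j) {t : ℂ} (ht : NotInt t) :
    transEnd k n (rOp i j t) = normalizedDynB i j t := by
  have h : transEnd n k (normalizedDynB i j t) = pairOp i j (rMatrix k t) := by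
    refine eq_pairOp hij fun c e he => ?_
    apply (transpose k n).injective
    rw [transpose_apply_end, transEnd_transEnd, map_mul (transpose k n), map_mul (transpose k n),
      transpose_rename_colPair, transpose_rename_colPair, transpose_apply_end, rMatrix_eq ht, transEnd_transEnd,
      transpose_monomial', transpose_monomial']
    refine normalizedDynB_rename_mul hij (fun b a hb => ?_) t _
    rw [expSwap_apply, he a b hb]
  rw [rOp, ← h, transEnd_transEnd]

lemma isUnit_rOp [NeZero k] (hij : i ≠ j) {t : ℂ} (ht : NotInt t) :
    IsUnit (rOp (k := k) i j t) := isUnit_pairOp hij (isUnit_rMatrix ht)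

/-- Invertibility of `R` is carried over by the duality; the factor `C` has no zeros and can be
removed. -/
lemma isUnit_dynB [NeZero k] (hij : i ≠ j) {t : ℂ} (ht : NotInt t) :
    IsUnit (dynB (n := k) i j t) := by
  have h := (isUnit_rOp (k := k) hij ht).map (transEnd k n)
  rw [transEnd_rOp hij ht, normalizedDynB] at h
  obtain ⟨u, hu⟩ := isUnit_weightOp (n := k) fun d => cVal_ne_zero i j ht d
  rw [← hu] at h
  exact (Units.isUnit_units_mul u _).mp h

end PairOp

end TensorFactors

/-! ## Duality of the difference operators -/

section DifferenceOperators

variable {k n : ℕ}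

/-- Each `C` is a function of the weights, so it passes to the left of every `B`. -/
lemma list_prod_normalizedDynB {ι : Type*} (L : List ι) (i j : ι → Fin k) (t : ι → ℂ)
    (hij : ∀ x ∈ L, i x ≠ j x) :
    (L.map fun x => (normalizedDynB (i x) (j x) (t x) : Module.End ℂ (P k n))).prod
      = weightOp (fun d => (L.map fun x => cVal (i x) (j x) (t x) d).prod)
        * (L.map fun x => dynB (i x) (j x) (t x)).prod := by
  induction L with
  | nil => simp [weightOp_one]
  | cons x L ih =>
    have h := weightOp_comm_dynB (n := n)
      (fun r => (L.map fun x => cWeight (i x) (j x) (t x) r).prod) (hij x (by simp)) (t x)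
    simp only [List.map_cons, List.prod_cons]
    rw [ih fun y hy => hij y (by simp [hy]), ← weightOp_mul, normalizedDynB]
    simp only [cVal_eq]
    rw [mul_assoc, ← mul_assoc (dynB _ _ _), ← h]
    simp only [mul_assoc]

lemma weightOp_comm_list_prod {ι : Type*} (g : (Fin k → ℤ) → ℂ) (L : List ι) (i j : ι → Fin k)
    (t : ι → ℂ) (hij : ∀ x ∈ L, i x ≠ j x) :
    Commute (weightOp (fun d => g (Finsupp.weight (rowWt k n) d)))
      (L.map fun x => dynB (i x) (j x) (t x)).prod := by
  refine Commute.list_prod_right _ _ fun A hA => ?_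
  obtain ⟨x, hx, rfl⟩ := List.mem_map.mp hA
  exact weightOp_comm_dynB g (hij x hx) (t x)

lemma list_prod_filter_finRange {p : Fin k → Prop} [DecidablePred p] (f : Fin k → ℂ) :
    (((List.finRange k).filter p).map f).prod = ∏ b with p b, f b := by
  rw [← List.prod_toFinset _ ((List.nodup_finRange k).filter _)]
  refine Finset.prod_congr ?_ fun _ _ => rfl
  ext b
  simp

lemma map_ringInverse {A B F : Type*} [MonoidWithZero A] [MonoidWithZero B] [FunLike F A B]
    [MonoidHomClass F A B] (f : F) {a : A} (ha : IsUnit a) :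
    f (Ring.inverse a) = Ring.inverse (f a) := by
  obtain ⟨u, rfl⟩ := ha
  rw [Ring.inverse_unit]
  exact (Ring.inverse_unit (Units.map (f : A →* B) u)).symm

lemma transEnd_weightOp (f : (Fin k × Fin n →₀ ℕ) → ℂ) :
    transEnd k n (weightOp f) = weightOp (fun d => f ((expSwap k n).symm d)) := by
  refine end_ext fun d => ?_
  obtain ⟨d, rfl⟩ := (expSwap k n).surjective d
  rw [← transpose_monomial', ← transpose_apply_end, weightOp_monomial, transpose_monomial',
    weightOp_monomial, map_smul, transpose_monomial', Equiv.symm_apply_apply]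

/-! ### The duality of the qKZ and difference dynamical operators -/

section Difference

variable [NeZero k] {κ : ℂ} {i : Fin n} {z : Fin n → ℂ}

lemma transEnd_rLeft (hz : ∀ j, i < j → NotInt (z i - z j)) :
    transEnd k n (rLeft i z)
      = weightOp (fun d => ∏ j with i < j, cVal i j (z i - z j) d) * dynLeft i z := by
  have hL : ∀ j ∈ ((List.finRange n).filter fun j => i < j).reverse, i < j := by
    intro j hj
    simpa using hj
  rw [rLeft, map_list_prod, List.map_map, dynLeft]
  have h1 : ∀ j ∈ ((List.finRange n).filter fun j => i < j).reverse,
      (transEnd k n ∘ fun j => rOp i j (z i - z j)) j = normalizedDynB i j (z i - z j) :=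
    fun j hj => transEnd_rOp (hL j hj).ne (hz j (hL j hj))
  rw [List.map_congr_left h1,
    list_prod_normalizedDynB _ (fun _ => i) (fun j => j) _ fun j hj => (hL j hj).ne]
  refine congrArg (fun g => weightOp g * _) (funext fun d => ?_)
  rw [List.map_reverse, List.prod_reverse, list_prod_filter_finRange]

lemma transEnd_rRight (hz : ∀ j, j < i → NotInt (z j - z i - κ)) :
    transEnd k n (rRight κ i z)
      = weightOp (fun d => ∏ j with j < i, cVal j i (z j - z i - κ) d) * dynRight κ i z := by
  have hL : ∀ j ∈ (List.finRange n).filter fun j => j < i, j < i := by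
    intro j hj
    simpa using hj
  rw [rRight, map_list_prod, List.map_map, dynRight]
  have h1 : ∀ j ∈ (List.finRange n).filter fun j => j < i,
      (transEnd k n ∘ fun j => rOp j i (z j - z i - κ)) j = normalizedDynB j i (z j - z i - κ) :=
    fun j hj => transEnd_rOp (hL j hj).ne (hz j (hL j hj))
  rw [List.map_congr_left h1,
    list_prod_normalizedDynB _ (fun j => j) (fun _ => i) _ fun j hj => (hL j hj).ne]
  refine congrArg (fun g => weightOp g * _) (funext fun d => ?_)
  rw [list_prod_filter_finRange]

lemma isUnit_rLeft (hz : ∀ j, i < j → NotInt (z i - z j)) : IsUnit (rLeft (k := k) i z) := by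
  refine List.prod_isUnit fun A hA => ?_
  obtain ⟨j, hj, rfl⟩ := List.mem_map.mp hA
  have hj : i < j := by simpa using hj
  exact isUnit_rOp hj.ne (hz j hj)

/-- The left product becomes `C_L B_L` and the right one `C_R B_R`. The inverse of the former is
`B_L⁻¹ C_L⁻¹`, and moving the weight functions to the left yields `C_R C_L⁻¹`, which is `N`. -/
lemma transEnd_qkzK (l : Fin k → ℂ) (hz : ∀ j, j < i → NotInt (z j - z i - κ))
    (hz' : ∀ j, i < j → NotInt (z i - z j)) :
    transEnd k n (qkzK κ i z l) = normN κ i z * dynX κ i l z := by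
  set gL : (Fin n → ℤ) → ℂ := fun r => ∏ j with i < j, cWeight i j (z i - z j) r with hgL
  set gR : (Fin n → ℤ) → ℂ := fun r => ∏ j with j < i, cWeight j i (z j - z i - κ) r with hgR
  have hL : transEnd k n (rLeft i z)
      = weightOp (fun d => gL (Finsupp.weight (rowWt n k) d)) * dynLeft i z := by
    rw [transEnd_rLeft hz']; simp only [cVal_eq, hgL]
  have hR : transEnd k n (rRight κ i z)
      = weightOp (fun d => gR (Finsupp.weight (rowWt n k) d)) * dynRight κ i z := by
    rw [transEnd_rRight hz]; simp only [cVal_eq, hgR]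
  have hN : (normN κ i z : Module.End ℂ (P n k))
      = weightOp (fun d => gR (Finsupp.weight (rowWt n k) d))
        * weightOp (fun d => (gL (Finsupp.weight (rowWt n k) d))⁻¹) := by
    rw [normN, weightOp_mul]
    simp only [cVal_eq, hgL, hgR, Finset.prod_inv_distrib]
  have hne : ∀ d : Fin n × Fin k →₀ ℕ, gL (Finsupp.weight (rowWt n k) d) ≠ 0 := by
    intro d
    refine Finset.prod_ne_zero_iff.mpr fun j hj => ?_
    have h := cVal_ne_zero i j (hz' j (Finset.mem_filter.mp hj).2) d
    rwa [cVal_eq] at h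
  have hcomm : ∀ g : (Fin n → ℤ) → ℂ,
      Commute (weightOp (fun d => g (Finsupp.weight (rowWt n k) d))) (dynLeft (n := k) i z) :=
    fun g => weightOp_comm_list_prod g _ (fun _ => i) (fun j => j) _ fun j hj => by
      have : i < j := by simpa using hj
      exact this.ne
  have hinv : Ring.inverse (weightOp (fun d => gL (Finsupp.weight (rowWt n k) d)))
      = weightOp (fun d => (gL (Finsupp.weight (rowWt n k) d))⁻¹) := by
    refine Ring.inverse_unit (⟨weightOp (fun d => gL (Finsupp.weight (rowWt n k) d)),
      weightOp (fun d => (gL (Finsupp.weight (rowWt n k) d))⁻¹), ?_, ?_⟩ :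
      (Module.End ℂ (P n k))ˣ)
    · rw [weightOp_mul, ← weightOp_one]; simp [hne]
    · rw [weightOp_mul, ← weightOp_one]; simp [hne]
  have hcomm' : ∀ g : (Fin n → ℤ) → ℂ,
      Commute (weightOp (fun d => g (Finsupp.weight (rowWt n k) d)))
        (Ring.inverse (dynLeft (n := k) i z)) := by
    intro g
    -- `dynLeft` is the dual of the invertible `rLeft` divided by a nonvanishing function of the
    -- weights.
    have hU : IsUnit (dynLeft (n := k) i z) := by
      have h := (isUnit_rLeft (k := k) hz').map (transEnd k n)
      rw [hL] at h
      obtain ⟨u, hu⟩ := isUnit_weightOp hne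
      rw [← hu] at h
      exact (Units.isUnit_units_mul u _).mp h
    obtain ⟨v, hv⟩ := hU
    have h := hcomm g
    rw [← hv] at h ⊢
    rw [Ring.inverse_unit]
    exact h.units_inv_right
  have hW : transEnd k n (weightOp (fun d => ∏ a : Fin k, l a ^ (-(d (a, i) : ℤ))))
      = weightOp (fun d => ∏ a : Fin k, l a ^ (-(d (i, a) : ℤ))) := by
    rw [transEnd_weightOp]
    refine congrArg weightOp (funext fun d => ?_)
    obtain ⟨d, rfl⟩ := (expSwap k n).surjective d
    simp only [Equiv.symm_apply_apply, expSwap_apply]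
  have hWcomm : ∀ f g : (Fin n × Fin k →₀ ℕ) → ℂ, weightOp f * weightOp g = weightOp g * weightOp f := by
    intro f g
    rw [weightOp_mul, weightOp_mul]
    simp only [mul_comm]
  rw [qkzK, map_mul, map_mul, hW, hR, hN, dynX,
    show transEnd k n (Ring.inverse (rLeft i z)) = Ring.inverse (transEnd k n (rLeft i z)) from
      map_ringInverse (transEnd k n) (isUnit_rLeft hz'), hL,
    Ring.mul_inverse_rev' (hcomm gL), hinv]
  set W := weightOp fun d : Fin n × Fin k →₀ ℕ => ∏ a : Fin k, l a ^ (-(d (i, a) : ℤ))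
  set WR := weightOp fun d : Fin n × Fin k →₀ ℕ => gR (Finsupp.weight (rowWt n k) d)
  set WL := weightOp fun d : Fin n × Fin k →₀ ℕ => (gL (Finsupp.weight (rowWt n k) d))⁻¹
  set I := Ring.inverse (dynLeft (n := k) i z)
  have c1 : WR * I = I * WR := hcomm' gR
  have c2 : WL * I = I * WL := hcomm' fun r => (gL r)⁻¹
  have c3 : WR * WL = WL * WR := hWcomm _ _
  -- `W` depends on the individual exponents and not only on the row weights, so it stays to the
  -- right of `I`; only its commutation with the diagonal operator `WR` is used.
  have c4 : W * WR = WR * W := hWcomm _ _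
  calc I * WL * W * (WR * dynRight κ i z) = I * WL * (W * WR) * dynRight κ i z := by
        simp only [mul_assoc]
    _ = I * (WL * WR) * W * dynRight κ i z := by rw [c4]; simp only [mul_assoc]
    _ = (I * WR) * WL * W * dynRight κ i z := by rw [← c3]; simp only [mul_assoc]
    _ = WR * (I * WL) * W * dynRight κ i z := by rw [← c1]; simp only [mul_assoc]
    _ = WR * WL * (I * W * dynRight κ i z) := by rw [← c2]; simp only [mul_assoc]

lemma dualize_qKZ (u : Fn k n) (l : Fin k → ℂ) (hz : ∀ j, j < i → NotInt (z j - z i - κ))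
    (hz' : ∀ j, i < j → NotInt (z i - z j)) :
    dualize (qKZ κ i u) l z = normN κ i z (diffDyn κ i (dualize u) l z) := by
  simp only [dualize, qKZ, diffDyn]
  rw [transpose_apply_end, transEnd_qkzK l hz hz']
  rfl

end Difference

lemma dualize_diffDyn [NeZero n] {κ : ℂ} {a : Fin k} {l : Fin k → ℂ} (u : Fn k n) (z : Fin n → ℂ)
    (hl : ∀ b, b < a → NotInt (l b - l a - κ)) (hl' : ∀ b, a < b → NotInt (l a - l b)) :
    dualize (fun z l => normN κ a l (diffDyn κ a u z l)) l z = qKZ κ a (dualize u) l z := by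
  have h := dualize_qKZ (dualize u) z hl hl'
  rw [dualize_dualize] at h
  simp only [dualize] at h ⊢
  rw [← h, transpose_transpose]

end DifferenceOperators

end GlDuality

end

theorem theorem5p8 (k n : ℕ) [NeZero k] [NeZero n] (κ : ℂ) (hκ : κ ≠ 0) :
    -- the R-matrices exist and are unique, and the inverses taken below are genuine inverses
    (∀ t : ℂ, GlDuality.NotInt t →
      (∃! R, GlDuality.IsRMatrix k t R) ∧ (∃! R, GlDuality.IsRMatrix n t R) ∧
      (∀ i j : Fin n, i ≠ j →
        IsUnit (GlDuality.rOp (k := k) i j t) ∧ IsUnit (GlDuality.dynB (n := k) i j t)) ∧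
      (∀ a b : Fin k, a ≠ b →
        IsUnit (GlDuality.rOp (k := n) a b t) ∧ IsUnit (GlDuality.dynB (n := n) a b t))) ∧
    -- differential operators
    (∀ (U : Set ((Fin n → ℂ) × (Fin k → ℂ))) (u : GlDuality.Fn k n),
      IsOpen U → GlDuality.IsHolo U u →
      ∀ (z : Fin n → ℂ) (l : Fin k → ℂ), (z, l) ∈ U →
        (∀ i : Fin n, (∀ j, j ≠ i → z i ≠ z j) →
          GlDuality.dualize (GlDuality.ratKZ κ i u) l z
              = GlDuality.ratDD κ i (GlDuality.dualize u) l z ∧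
          GlDuality.dualize (GlDuality.trigKZ κ i u) l z
              = GlDuality.trigDD κ i (GlDuality.dualize u) l z) ∧
        (∀ a : Fin k, (∀ b, b ≠ a → l a ≠ l b) →
          GlDuality.dualize (GlDuality.ratDD κ a u) l z
              = GlDuality.ratKZ κ a (GlDuality.dualize u) l z ∧
          GlDuality.dualize (GlDuality.trigDD κ a u) l z
              = GlDuality.trigKZ κ a (GlDuality.dualize u) l z)) ∧
    -- difference operators
    (∀ (u : GlDuality.Fn k n) (z : Fin n → ℂ) (l : Fin k → ℂ),
      (∀ i : Fin n, (∀ a, l a ≠ 0) →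
        (∀ j, j < i → GlDuality.NotInt (z j - z i - κ)) →
        (∀ j, i < j → GlDuality.NotInt (z i - z j)) →
          GlDuality.dualize (GlDuality.qKZ κ i u) l z
            = GlDuality.normN κ i z (GlDuality.diffDyn κ i (GlDuality.dualize u) l z)) ∧
      (∀ a : Fin k, (∀ i, z i ≠ 0) →
        (∀ b, b < a → GlDuality.NotInt (l b - l a - κ)) →
        (∀ b, a < b → GlDuality.NotInt (l a - l b)) →
          GlDuality.dualize
              (fun z l => GlDuality.normN κ a l (GlDuality.diffDyn κ a u z l)) l z
            = GlDuality.qKZ κ a (GlDuality.dualize u) l z)) := by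
  refine ⟨fun t ht => ⟨GlDuality.existsUnique_isRMatrix ht, GlDuality.existsUnique_isRMatrix ht,
    fun i j hij => ⟨GlDuality.isUnit_rOp hij ht, GlDuality.isUnit_dynB hij ht⟩,
    fun a b hab => ⟨GlDuality.isUnit_rOp hab ht, GlDuality.isUnit_dynB hab ht⟩⟩,
    fun U u _ _ z l _ => ⟨fun i hz => ⟨GlDuality.dualize_ratKZ κ i u z l,
      GlDuality.dualize_trigKZ κ i u z l hz⟩,
      fun a hl => ⟨GlDuality.dualize_ratDD κ a u z l, GlDuality.dualize_trigDD κ a u z l hl⟩⟩,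
    fun u z l => ⟨fun i _ hz hz' => GlDuality.dualize_qKZ u l hz hz',
      fun a _ hl hl' => GlDuality.dualize_diffDyn u z hl hl'⟩⟩
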